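/- All graphs are finite and simple; the null graph is allowed, and graphs are considered up to isomorphism. $P_5$ is the path on five vertices, $\overline{G}$ is the complement of $G$, and $G$ is $\{P_5,\overline{P_5}\}$-free if it has no induced subgraph isomorphic to $P_5$ or to $\overline{P_5}$. A pentagon is a cycle on five vertices. A split graph is a graph whose vertex set can be partitioned into a (possibly empty) clique and a (possibly empty) stable set. For disjoint vertex sets $X,Y$, $X$ is complete to $Y$ if every vertex of $X$ is adjacent to every vertex of $Y$, and anti-complete to $Y$ if no vertex of $X$ is adjacent to a vertex of $Y$; a vertex $v$ is complete (anti-complete) to $Y$ if $\{v\}$ is. Substitution. Given graphs $G_1,G_2$ with disjoint vertex sets and a vertex $u$ of $G_2$, the graph obtained by substituting $G_1$ for $u$ in $G_2$ is the graph $G$ with vertex set $V_{G_1}\cup(V_{G_2}\smallsetminus\{u\})$ such that $G[V_{G_1}]=G_1$, $G[V_{G_2}\smallsetminus\{u\}]=G_2\smallsetminus u$, and each $v\in V_{G_2}\smallsetminus\{u\}$ is complete to $V_{G_1}$ in $G$ if $v$ is adjacent to $u$ in $G_2$, and anti-complete to $V_{G_1}$ in $G$ otherwise. Split graph unification. Let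 $A,B,C,L,T$ be pairwise disjoint sets with $A$ and $C$ non-empty, and let $a\neq c$ be vertices outside $A\cup B\cup C\cup L\cup T$. Let $G_1$ be a graph with vertex set $A\cup L\cup T\cup\{c\}$ in which $L$ is a clique, $T$ is a stable set, $A$ is anti-complete to $T$, and $c$ is complete to $L$ and anti-complete to $A\cup T$. Let $G_2$ be a graph with vertex set $B\cup C\cup L\cup T\cup\{a\}$ such that $G_2[L\cup T]=G_1[L\cup T]$, $T$ is anti-complete to $C$, $L$ is complete to $B\cup C$, and $a$ is complete to $B$ and anti-complete to $C\cup L\cup T$. The split graph unification of $(G_1,G_2)$ is the graph $G$ with vertex set $A\cup B\cup C\cup L\cup T$ such that $G[A\cup L\cup T]=G_1\smallsetminus c$, $G[B\cup C\cup L\cup T]=G_2\smallsetminus a$, and $A$ is complete to $B$ and anti-complete to $C$ in $G$. A graph $G$ is obtained from $G_1$ and $G_2$ by split graph unification in the complement if $\overline{G}$ is the split graph unification of $(G_1,G_2)$. Theorem. A graph is $\{P_5,\overline{P_5}\}$-free if and only if it is obtained from pentagons and split graphs by repeated substitutions, split graph unifications, and split graph unifications in the complement, that is, if and only if it belongs to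 the smallest isomorphism-closed class of graphs that contains all pentagons and all split graphs and is closed under these three operations. -/

import Mathlib

universe u

namespace SplitUnif

/-- `G` has no induced subgraph isomorphic to `H`. -/
def IsFree {V W : Type*} (H : SimpleGraph W) (G : SimpleGraph V) : Prop :=
  ¬ H.IsIndContained G

/-- The path `P₅` on five vertices (with four edges). -/
abbrev P5 : SimpleGraph (Fin 5) := SimpleGraph.pathGraph 5

/-- `G` contains neither the path on five vertices nor its complement (the house) as an
induced subgraph. -/
def IsP5HouseFree {V : Type*} (G : SimpleGraph V) : Prop :=
  IsFree P5 G ∧ IsFree P5ᶜ G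

/-- `G` is a cycle on five vertices. -/
def IsPentagon {V : Type*} (G : SimpleGraph V) : Prop :=
  Nonempty (G ≃g SimpleGraph.cycleGraph 5)

/-- The vertex set of `G` is the disjoint union of a clique and a stable set (either may be
empty). -/
def IsSplitGraph {V : Type*} (G : SimpleGraph V) : Prop :=
  ∃ K S : Set V, K ∪ S = Set.univ ∧ Disjoint K S ∧ G.IsClique K ∧ G.IsIndepSet S

/-- `G` is obtained by substituting `G₁` for the vertex `u` in `G₂`. The vertex set of `G` is the
disjoint union of the vertex set of `G₁` and of the vertex set of `G₂` with `u` removed. -/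
structure IsSubstitution {V₁ V₂ : Type u} (G₁ : SimpleGraph V₁) (G₂ : SimpleGraph V₂) (u : V₂)
    (G : SimpleGraph (V₁ ⊕ {v : V₂ // v ≠ u})) : Prop where
  /-- `G[V₁] = G₁` -/
  induce_left : G.comap Sum.inl = G₁
  /-- `G[V₂ ∖ {u}] = G₂ ∖ u` -/
  induce_right : G.comap Sum.inr = G₂.comap Subtype.val
  complete : ∀ v : {v : V₂ // v ≠ u}, G₂.Adj v u → ∀ x : V₁, G.Adj (Sum.inr v) (Sum.inl x)
  anticomplete :
    ∀ v : {v : V₂ // v ≠ u}, ¬ G₂.Adj v u → ∀ x : V₁, ¬ G.Adj (Sum.inr v) (Sum.inl x)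

/-- The disjoint union `A ∪ L ∪ T`. -/
inductive VertALT (A L T : Type u) : Type u
  | ofA (x : A)
  | ofL (x : L)
  | ofT (x : T)

/-- The disjoint union `B ∪ C ∪ L ∪ T`. -/
inductive VertBCLT (B C L T : Type u) : Type u
  | ofB (x : B)
  | ofC (x : C)
  | ofL (x : L)
  | ofT (x : T)

/-- The disjoint union `A ∪ B ∪ C ∪ L ∪ T`. -/
inductive VertABCLT (A B C L T : Type u) : Type u
  | ofA (x : A)
  | ofB (x : B)
  | ofC (x : C)
  | ofL (x : L)
  | ofT (x : T)

/-- The inclusion of `A ∪ L ∪ T` in `A ∪ B ∪ C ∪ L ∪ T`. -/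
def VertALT.incl {A L T : Type u} (B C : Type u) : VertALT A L T → VertABCLT A B C L T
  | .ofA x => .ofA x
  | .ofL x => .ofL x
  | .ofT x => .ofT x

/-- The inclusion of `B ∪ C ∪ L ∪ T` in `A ∪ B ∪ C ∪ L ∪ T`. -/
def VertBCLT.incl {B C L T : Type u} (A : Type u) : VertBCLT B C L T → VertABCLT A B C L T
  | .ofB x => .ofB x
  | .ofC x => .ofC x
  | .ofL x => .ofL x
  | .ofT x => .ofT x

/-- The inclusion of `L ∪ T` in `A ∪ L ∪ T`. -/
def coreALT {L T : Type u} (A : Type u) : L ⊕ T → VertALT A L T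
  | .inl x => .ofL x
  | .inr x => .ofT x

/-- The inclusion of `L ∪ T` in `B ∪ C ∪ L ∪ T`. -/
def coreBCLT {L T : Type u} (B C : Type u) : L ⊕ T → VertBCLT B C L T
  | .inl x => .ofL x
  | .inr x => .ofT x

/-- `(G₁, G₂)` is a composable pair, where `G₁` has vertex set `A ∪ L ∪ T ∪ {c}` and `G₂` has
vertex set `B ∪ C ∪ L ∪ T ∪ {a}`. The extra vertices `c` of `G₁` and `a` of `G₂` are the elements
`none` of the respective `Option` types. -/
structure IsComposablePair {A B C L T : Type u} (G₁ : SimpleGraph (Option (VertALT A L T)))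
    (G₂ : SimpleGraph (Option (VertBCLT B C L T))) : Prop where
  nonempty_A : Nonempty A
  nonempty_C : Nonempty C
  /-- `L` is a clique in `G₁` -/
  clique_L : ∀ x y : L, x ≠ y → G₁.Adj (some (.ofL x)) (some (.ofL y))
  /-- `T` is a stable set in `G₁` -/
  stable_T : ∀ x y : T, ¬ G₁.Adj (some (.ofT x)) (some (.ofT y))
  /-- `A` is anti-complete to `T` in `G₁` -/
  A_anticomplete_T : ∀ (x : A) (y : T), ¬ G₁.Adj (some (.ofA x)) (some (.ofT y))
  /-- `c` is complete to `L` in `G₁` -/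
  c_complete_L : ∀ x : L, G₁.Adj none (some (.ofL x))
  /-- `c` is anti-complete to `A` in `G₁` -/
  c_anticomplete_A : ∀ x : A, ¬ G₁.Adj none (some (.ofA x))
  /-- `c` is anti-complete to `T` in `G₁` -/
  c_anticomplete_T : ∀ x : T, ¬ G₁.Adj none (some (.ofT x))
  /-- `G₂[L ∪ T] = G₁[L ∪ T]` -/
  core_eq : G₂.comap (fun x => some (coreBCLT B C x)) = G₁.comap (fun x => some (coreALT A x))
  /-- `T` is anti-complete to `C` in `G₂` -/
  T_anticomplete_C : ∀ (x : T) (y : C), ¬ G₂.Adj (some (.ofT x)) (some (.ofC y))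
  /-- `L` is complete to `B` in `G₂` -/
  L_complete_B : ∀ (x : L) (y : B), G₂.Adj (some (.ofL x)) (some (.ofB y))
  /-- `L` is complete to `C` in `G₂` -/
  L_complete_C : ∀ (x : L) (y : C), G₂.Adj (some (.ofL x)) (some (.ofC y))
  /-- `a` is complete to `B` in `G₂` -/
  a_complete_B : ∀ x : B, G₂.Adj none (some (.ofB x))
  /-- `a` is anti-complete to `C` in `G₂` -/
  a_anticomplete_C : ∀ x : C, ¬ G₂.Adj none (some (.ofC x))
  /-- `a` is anti-complete to `L` in `G₂` -/
  a_anticomplete_L : ∀ x : L, ¬ G₂.Adj none (some (.ofL x))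
  /-- `a` is anti-complete to `T` in `G₂` -/
  a_anticomplete_T : ∀ x : T, ¬ G₂.Adj none (some (.ofT x))

/-- `(G₁, G₂)` is a composable pair and `G` is its split graph unification. -/
structure IsUnification {A B C L T : Type u} (G₁ : SimpleGraph (Option (VertALT A L T)))
    (G₂ : SimpleGraph (Option (VertBCLT B C L T))) (G : SimpleGraph (VertABCLT A B C L T)) :
    Prop where
  composable : IsComposablePair G₁ G₂
  /-- `G[A ∪ L ∪ T] = G₁ ∖ c` -/
  induce_left : G.comap (VertALT.incl B C) = G₁.comap some
  /-- `G[B ∪ C ∪ L ∪ T] = G₂ ∖ a` -/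
  induce_right : G.comap (VertBCLT.incl A) = G₂.comap some
  /-- `A` is complete to `B` in `G` -/
  A_complete_B : ∀ (x : A) (y : B), G.Adj (.ofA x) (.ofB y)
  /-- `A` is anti-complete to `C` in `G` -/
  A_anticomplete_C : ∀ (x : A) (y : C), ¬ G.Adj (.ofA x) (.ofC y)

/-- The (finite) graphs obtained from pentagons and split graphs by repeatedly applying
substitution, split graph unification, and split graph unification in the complement: the smallest
isomorphism-closed class that contains the pentagons and the finite split graphs and is closed
under the three operations. -/
inductive Obtained : {V : Type u} → SimpleGraph V → Prop
  | pentagon {V : Type u} {G : SimpleGraph V} (h : IsPentagon G) : Obtained G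
  | split {V : Type u} [Finite V] {G : SimpleGraph V} (h : IsSplitGraph G) : Obtained G
  | iso {V W : Type u} {G : SimpleGraph V} {H : SimpleGraph W} (e : G ≃g H) (hG : Obtained G) :
      Obtained H
  | substitution {V₁ V₂ : Type u} {G₁ : SimpleGraph V₁} {G₂ : SimpleGraph V₂} {u : V₂}
      {G : SimpleGraph (V₁ ⊕ {v : V₂ // v ≠ u})} (h : IsSubstitution G₁ G₂ u G)
      (h₁ : Obtained G₁) (h₂ : Obtained G₂) : Obtained G
  | unification {A B C L T : Type u} {G₁ : SimpleGraph (Option (VertALT A L T))}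
      {G₂ : SimpleGraph (Option (VertBCLT B C L T))} {G : SimpleGraph (VertABCLT A B C L T)}
      (h : IsUnification G₁ G₂ G) (h₁ : Obtained G₁) (h₂ : Obtained G₂) : Obtained G
  | unificationCompl {A B C L T : Type u} {G₁ : SimpleGraph (Option (VertALT A L T))}
      {G₂ : SimpleGraph (Option (VertBCLT B C L T))} {G : SimpleGraph (VertABCLT A B C L T)}
      (h : IsUnification G₁ G₂ Gᶜ) (h₁ : Obtained G₁) (h₂ : Obtained G₂) : Obtained G

end SplitUnif

namespace SplitUnif

open SimpleGraph

/-! ### The two forbidden graphs -/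

/-! Freeness survives the operations. `P5` and the house are prime, so a copy in a substitution lies
inside the substituted graph or meets it in at most one vertex (`IsP5OrHouse.homogeneous`). For a
copy in a unification, a finite check over labellings of its five vertices by `A`, `B`, `C`, `L`,
`T` (`IsP5OrHouse.labelling`) shows that it can be carried into `G₁`, with `c` replacing a vertex of
`C`, or into `G₂`, with `a` replacing a vertex of `A`. Unification in the complement follows because
the forbidden pair is closed under complementation.

The converse is by induction on the number of vertices. A proper homogeneous set with at least two
vertices yields a substitution. A prime graph without induced 2K₂ and C₄ is split, or contains a
pentagon and then equals it. As C₄ is the complement of 2K₂, what remains is a prime free graph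
containing 2K₂, up to complementation (`exists_divide`).

There, let `A` be a maximal connected set with at least two vertices such that some edge has both
ends remote from `A`. Maximality controls the set `X` of outside vertices with a neighbor in `A`. If
the vertices mixed on `A` form a clique, `A` is the first part of a split graph unification. If not,
some component `Q` of the complement of `G[X]` is the first part of one in the complement.

A divide gives two smaller blocks (`IsDivide.exists_unification`). `G₁` is an induced subgraph of
`G`; `G₂` need not be, and its freeness is `rightBlock_isP5HouseFree`. -/

instance : DecidableRel P5.Adj := fun _ _ => decidable_of_iff _ pathGraph_adj.symm

theorem IsP5HouseFree.of_embedding {V W : Type*} {G : SimpleGraph V} {H : SimpleGraph W}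
    (e : H ↪g G) (hG : IsP5HouseFree G) : IsP5HouseFree H :=
  ⟨fun ⟨f⟩ => hG.1 ⟨e.comp f⟩, fun ⟨f⟩ => hG.2 ⟨e.comp f⟩⟩

theorem IsP5HouseFree.compl {V : Type*} {G : SimpleGraph V} (hG : IsP5HouseFree G) :
    IsP5HouseFree Gᶜ := by
  refine ⟨fun h => hG.2 ?_, fun h => hG.1 (compl_isIndContained_compl.1 h)⟩
  have := compl_isIndContained_compl.2 h
  rwa [compl_compl] at this

theorem isP5HouseFree_compl_iff {V : Type*} {G : SimpleGraph V} :
    IsP5HouseFree Gᶜ ↔ IsP5HouseFree G :=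
  ⟨fun h => by simpa using h.compl, IsP5HouseFree.compl⟩

/-- `H` is the path on five vertices or its complement. -/
def IsP5OrHouse (H : SimpleGraph (Fin 5)) : Prop := H = P5 ∨ H = P5ᶜ

theorem isP5HouseFree_iff {V : Type*} {G : SimpleGraph V} :
    IsP5HouseFree G ↔ ∀ H, IsP5OrHouse H → IsFree H G := by
  refine ⟨?_, fun h => ⟨h _ (.inl rfl), h _ (.inr rfl)⟩⟩
  rintro h H (rfl | rfl)
  exacts [h.1, h.2]

/-- An injective map which preserves and reflects adjacency is an induced embedding. -/
theorem isIndContained_of_map {V W : Type*} {H : SimpleGraph W} {G : SimpleGraph V} (f : W → V)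
    (hf : Function.Injective f) (h : ∀ i j, G.Adj (f i) (f j) ↔ H.Adj i j) : H.IsIndContained G :=
  ⟨⟨⟨f, hf⟩, h _ _⟩⟩

theorem IsP5HouseFree.no_path {V : Type*} {G : SimpleGraph V} (hG : IsP5HouseFree G)
    {a b c d e : V} (h₁ : G.Adj a b) (h₂ : G.Adj b c) (h₃ : G.Adj c d) (h₄ : G.Adj d e)
    (h₅ : ¬ G.Adj a c) (h₆ : ¬ G.Adj a d) (h₇ : ¬ G.Adj a e) (h₈ : ¬ G.Adj b d)
    (h₉ : ¬ G.Adj b e) (h₀ : ¬ G.Adj c e) : False := by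
  have key : ∀ i j : Fin 5, G.Adj (![a, b, c, d, e] i) (![a, b, c, d, e] j) ↔ P5.Adj i j := by
    intro i j
    fin_cases i <;> fin_cases j <;>
      simp [pathGraph_adj, h₁, h₂, h₃, h₄, h₅, h₆, h₇, h₈, h₉, h₀, h₁.symm, h₂.symm, h₃.symm,
        h₄.symm, G.adj_comm c a, G.adj_comm d a, G.adj_comm e a, G.adj_comm d b, G.adj_comm e b,
        G.adj_comm e c]
  refine hG.1 (isIndContained_of_map _ ?_ key)
  -- Distinct vertices of `P5` have distinct neighborhoods, so the adjacencies alone force the five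
  -- vertices to be distinct.
  intro i j hij
  have : ∀ k, P5.Adj i k ↔ P5.Adj j k := fun k => by rw [← key, ← key, hij]
  revert i j
  have : ∀ i j : Fin 5, (∀ k, P5.Adj i k ↔ P5.Adj j k) → i = j := by decide
  exact fun i j _ h => this i j h

/-- The vertices are listed along the path of the complement. Non-adjacency permits equality, so
consecutive vertices are separated by means of a third one. -/
theorem IsP5HouseFree.no_house {V : Type*} {G : SimpleGraph V} (hG : IsP5HouseFree G)
    {a b c d e : V} (h₁ : ¬ G.Adj a b) (h₂ : ¬ G.Adj b c) (h₃ : ¬ G.Adj c d) (h₄ : ¬ G.Adj d e)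
    (h₅ : G.Adj a c) (h₆ : G.Adj a d) (h₇ : G.Adj a e) (h₈ : G.Adj b d)
    (h₉ : G.Adj b e) (h₀ : G.Adj c e) : False := by
  have n₁ : a ≠ b := fun h => h₂ (h ▸ h₅)
  have n₂ : b ≠ c := fun h => h₃ (h ▸ h₈)
  have n₃ : c ≠ d := fun h => h₄ (h ▸ h₀)
  have n₄ : d ≠ e := fun h => h₃ (h ▸ h₀)
  refine hG.compl.no_path (a := a) (b := b) (c := c) (d := d) (e := e) ?_ ?_ ?_ ?_ ?_ ?_ ?_ ?_ ?_
    ?_ <;> simp_all [compl_adj]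

/-! ### Substitution and unification preserve the class -/

/-- Both graphs are prime. Encoding the set by five Booleans makes this a finite check. -/
theorem IsP5OrHouse.homogeneous {H : SimpleGraph (Fin 5)} (hH : IsP5OrHouse H) (S : Fin 5 → Prop)
    (hS : ∀ i, ¬ S i → (∀ j, S j → H.Adj i j) ∨ (∀ j, S j → ¬ H.Adj i j)) :
    (∀ i, S i) ∨ ∀ i j, S i → S j → i = j := by
  classical
  have key : ∀ s0 s1 s2 s3 s4 : Bool, ∀ S : Fin 5 → Bool, S = ![s0, s1, s2, s3, s4] →
      (∀ i, ¬ S i → (∀ j, S j → H.Adj i j) ∨ (∀ j, S j → ¬ H.Adj i j)) →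
      (∀ i, S i) ∨ ∀ i j, S i → S j → i = j := by
    intro s0 s1 s2 s3 s4
    rw [forall_eq]
    revert s0 s1 s2 s3 s4
    rcases hH with rfl | rfl <;> decide
  have := key (decide (S 0)) (decide (S 1)) (decide (S 2)) (decide (S 3)) (decide (S 4))
    (fun i => decide (S i)) (by ext i; fin_cases i <;> rfl)
  simpa using this (by simpa using hS)

theorem IsSubstitution.isP5HouseFree {V₁ V₂ : Type u} {G₁ : SimpleGraph V₁} {G₂ : SimpleGraph V₂}
    {u : V₂} {G : SimpleGraph (V₁ ⊕ {v : V₂ // v ≠ u})} (h : IsSubstitution G₁ G₂ u G)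
    (h₁ : IsP5HouseFree G₁) (h₂ : IsP5HouseFree G₂) : IsP5HouseFree G := by
  rw [isP5HouseFree_iff]
  rintro H hH ⟨f⟩
  have hl : ∀ x y, G.Adj (.inl x) (.inl y) ↔ G₁.Adj x y := fun x y => by
    rw [← h.induce_left]; rfl
  have hr : ∀ x y : {v : V₂ // v ≠ u}, G.Adj (.inr x) (.inr y) ↔ G₂.Adj x y := fun x y => by
    have := congrArg (fun K => K.Adj x y) h.induce_right
    simpa using this
  have hrl : ∀ (v : {v : V₂ // v ≠ u}) (x : V₁), G.Adj (.inr v) (.inl x) ↔ G₂.Adj v u :=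
    fun v x => ⟨fun hv => by_contra fun hn => h.anticomplete v hn x hv, fun hv => h.complete v hv x⟩
  have hlr : ∀ (v : {v : V₂ // v ≠ u}) (x : V₁), G.Adj (.inl x) (.inr v) ↔ G₂.Adj u v :=
    fun v x => by rw [G.adj_comm, hrl, G₂.adj_comm]
  have hom : ∀ i, ¬ (f i).isLeft → (∀ j, (f j).isLeft → H.Adj i j) ∨
      (∀ j, (f j).isLeft → ¬ H.Adj i j) := by
    intro i hi
    rcases hv : f i with x | v
    · simp [hv] at hi
    by_cases hu : G₂.Adj v u
    · left
      intro j hj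
      rcases hw : f j with x | w
      · rw [← f.map_adj_iff, hv, hw, hrl]; exact hu
      · simp [hw] at hj
    · right
      intro j hj
      rcases hw : f j with x | w
      · rw [← f.map_adj_iff, hv, hw, hrl]; exact hu
      · simp [hw] at hj
  rcases hH.homogeneous (fun i => (f i).isLeft) hom with hS | hS
  · refine isP5HouseFree_iff.1 h₁ H hH (isIndContained_of_map (fun i => (f i).getLeft (hS i)) ?_ ?_)
    · intro i j hij
      apply f.injective
      rw [← Sum.inl_getLeft _ (hS i), ← Sum.inl_getLeft _ (hS j)]
      exact congrArg _ hij
    · intro i j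
      rw [← hl, Sum.inl_getLeft, Sum.inl_getLeft, f.map_adj_iff]
  · refine isP5HouseFree_iff.1 h₂ H hH
      (isIndContained_of_map (fun i => Sum.elim (fun _ => u) Subtype.val (f i)) ?_ ?_)
    · intro i j hij
      rcases hi : f i with x | x <;> rcases hj : f j with y | y <;>
        simp only [hi, hj, Sum.elim_inl, Sum.elim_inr] at hij
      · exact hS i j (by simp [hi]) (by simp [hj])
      · exact absurd hij.symm y.2
      · exact absurd hij x.2
      · apply f.injective
        rw [hi, hj, Subtype.ext hij]
    · intro i j
      rw [← f.map_adj_iff]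
      rcases hi : f i with x | x <;> rcases hj : f j with y | y
      · have : i = j := hS i j (by simp [hi]) (by simp [hj])
        subst this
        simp_all
      · simp [hlr]
      · simp [hrl]
      · simp [hr]

/-- The five parts of a split graph unification. -/
inductive Part
  | A | B | C | L | T
  deriving DecidableEq

/-- Whether the adjacency `b` is allowed between distinct vertices in the given parts. -/
def Part.compatible : Part → Part → Bool → Bool
  | .A, .B, b => b
  | .B, .A, b => b
  | .A, .C, b => !b
  | .C, .A, b => !b
  | .A, .T, b => !b
  | .T, .A, b => !b
  | .T, .C, b => !b
  | .C, .T, b => !b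
  | .T, .T, b => !b
  | .L, .L, b => b
  | .L, .B, b => b
  | .B, .L, b => b
  | .L, .C, b => b
  | .C, .L, b => b
  | _, _, _ => true

def Part.all (p : Part → Bool) : Bool := p .A && p .B && p .C && p .L && p .T

theorem Part.all_iff {p : Part → Bool} : Part.all p = true ↔ ∀ x, p x = true := by
  simp only [Part.all, Bool.and_eq_true]
  exact ⟨fun ⟨⟨⟨⟨a, b⟩, c⟩, l⟩, t⟩ x => by cases x <;> assumption,
    fun h => ⟨⟨⟨⟨h _, h _⟩, h _⟩, h _⟩, h _⟩⟩

instance {p : Part → Prop} [DecidablePred p] : Decidable (∀ x, p x) :=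
  decidable_of_iff (Part.all (fun x => decide (p x)) = true) (by simp [Part.all_iff])

/-- The possible shapes of a labelling of `H` by the parts of a unification. -/
def GoodLabelling (H : SimpleGraph (Fin 5)) (l : Fin 5 → Part) : Prop :=
  (∀ i, l i ≠ .A) ∨ ((∀ i, l i ≠ .B) ∧ ∀ i j, l i = .C → l j = .C → i = j) ∨
    ((∀ i j, l i = .A → l j = .A → i = j) ∧ ∀ i j, l i = .A → l j = .L → ¬ H.Adj i j)

instance {H : SimpleGraph (Fin 5)} [DecidableRel H.Adj] {l : Fin 5 → Part} :
    Decidable (GoodLabelling H l) := by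
  unfold GoodLabelling
  infer_instance

/-- Every labelling of `H` which is compatible with its adjacency is good. -/
def AllLabellingsGood (H : SimpleGraph (Fin 5)) [DecidableRel H.Adj] : Prop :=
  ∀ l0 l1, l0.compatible l1 (decide (H.Adj 0 1)) = true →
    ∀ l2, (l0.compatible l2 (decide (H.Adj 0 2)) && l1.compatible l2 (decide (H.Adj 1 2))) = true →
    ∀ l3, (l0.compatible l3 (decide (H.Adj 0 3)) && l1.compatible l3 (decide (H.Adj 1 3)) &&
      l2.compatible l3 (decide (H.Adj 2 3))) = true →
    ∀ l4, (l0.compatible l4 (decide (H.Adj 0 4)) && l1.compatible l4 (decide (H.Adj 1 4)) &&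
      l2.compatible l4 (decide (H.Adj 2 4)) && l3.compatible l4 (decide (H.Adj 3 4))) = true →
    GoodLabelling H ![l0, l1, l2, l3, l4]

instance {H : SimpleGraph (Fin 5)} [DecidableRel H.Adj] : Decidable (AllLabellingsGood H) := by
  unfold AllLabellingsGood
  infer_instance

theorem AllLabellingsGood.good {H : SimpleGraph (Fin 5)} [DecidableRel H.Adj]
    (h : AllLabellingsGood H) {l : Fin 5 → Part}
    (hl : ∀ i j, i ≠ j → (l i).compatible (l j) (decide (H.Adj i j)) = true) :
    GoodLabelling H l := by
  have : l = ![l 0, l 1, l 2, l 3, l 4] := by ext i; fin_cases i <;> rfl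
  rw [this]
  refine h _ _ (hl _ _ (by decide)) _ ?_ _ ?_ _ ?_ <;> simp only [Bool.and_eq_true]
  · exact ⟨hl _ _ (by decide), hl _ _ (by decide)⟩
  · exact ⟨⟨hl _ _ (by decide), hl _ _ (by decide)⟩, hl _ _ (by decide)⟩
  · exact ⟨⟨⟨hl _ _ (by decide), hl _ _ (by decide)⟩, hl _ _ (by decide)⟩, hl _ _ (by decide)⟩

/-- Compatibility is tested after each new label, so the enumeration drops bad prefixes early
instead of visiting every labelling. -/
theorem allLabellingsGood_P5 : AllLabellingsGood P5 := by decide +kernel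

theorem allLabellingsGood_house : AllLabellingsGood P5ᶜ := by decide +kernel

theorem IsP5OrHouse.labelling {H : SimpleGraph (Fin 5)} (hH : IsP5OrHouse H) (l : Fin 5 → Part)
    (hl : ∀ i j, i ≠ j → ∀ b : Bool, (b = true ↔ H.Adj i j) → (l i).compatible (l j) b = true) :
    GoodLabelling H l := by
  rcases hH with rfl | rfl
  · exact allLabellingsGood_P5.good fun i j hij => hl i j hij _ (by simp)
  · exact allLabellingsGood_house.good fun i j hij => hl i j hij _ (by simp)

/-- The part of a vertex of a split graph unification. -/
def VertABCLT.part {A B C L T : Type u} : VertABCLT A B C L T → Part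
  | .ofA _ => .A
  | .ofB _ => .B
  | .ofC _ => .C
  | .ofL _ => .L
  | .ofT _ => .T

/-- The map to the vertex set of `G₁` which sends `B ∪ C` to `c`. -/
def VertABCLT.toLeft {A B C L T : Type u} : VertABCLT A B C L T → Option (VertALT A L T)
  | .ofA x => some (.ofA x)
  | .ofB _ => none
  | .ofC _ => none
  | .ofL x => some (.ofL x)
  | .ofT x => some (.ofT x)

/-- The map to the vertex set of `G₂` which sends `A` to `a`. -/
def VertABCLT.toRight {A B C L T : Type u} : VertABCLT A B C L T → Option (VertBCLT B C L T)
  | .ofA _ => none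
  | .ofB x => some (.ofB x)
  | .ofC x => some (.ofC x)
  | .ofL x => some (.ofL x)
  | .ofT x => some (.ofT x)

/-! ### Carrying a forbidden subgraph of a unification into one of its blocks -/

section

variable {A B C L T : Type u} {G₁ : SimpleGraph (Option (VertALT A L T))}
    {G₂ : SimpleGraph (Option (VertBCLT B C L T))} {G : SimpleGraph (VertABCLT A B C L T)}

theorem IsUnification.adj_left (h : IsUnification G₁ G₂ G) (x y : VertALT A L T) :
    G.Adj (x.incl B C) (y.incl B C) ↔ G₁.Adj (some x) (some y) := by
  have := congrArg (fun K => K.Adj x y) h.induce_left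
  simpa using this

theorem IsUnification.adj_right (h : IsUnification G₁ G₂ G) (x y : VertBCLT B C L T) :
    G.Adj (x.incl A) (y.incl A) ↔ G₂.Adj (some x) (some y) := by
  have := congrArg (fun K => K.Adj x y) h.induce_right
  simpa using this

open Classical in
theorem IsUnification.compatible (h : IsUnification G₁ G₂ G) (x y : VertABCLT A B C L T)
    (hxy : x ≠ y) : x.part.compatible y.part (decide (G.Adj x y)) = true := by
  have hc := h.composable
  have hl := h.adj_left
  have hr := h.adj_right
  cases x <;> cases y <;> simp only [VertABCLT.part, Part.compatible, decide_eq_true_eq,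
    Bool.not_eq_true', decide_eq_false_iff_not]
  · exact h.A_complete_B _ _
  · exact h.A_anticomplete_C _ _
  · exact fun hn => hc.A_anticomplete_T _ _ ((hl (.ofA _) (.ofT _)).1 hn)
  · exact (h.A_complete_B _ _).symm
  · exact ((hr (.ofL _) (.ofB _)).2 (hc.L_complete_B _ _)).symm
  · exact fun hn => h.A_anticomplete_C _ _ hn.symm
  · exact ((hr (.ofL _) (.ofC _)).2 (hc.L_complete_C _ _)).symm
  · exact fun hn => hc.T_anticomplete_C _ _ ((hr (.ofT _) (.ofC _)).1 hn.symm)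
  · exact (hr (.ofL _) (.ofB _)).2 (hc.L_complete_B _ _)
  · exact (hr (.ofL _) (.ofC _)).2 (hc.L_complete_C _ _)
  · exact (hl (.ofL _) (.ofL _)).2 (hc.clique_L _ _ fun h => hxy (h ▸ rfl))
  · exact fun hn => hc.A_anticomplete_T _ _ ((hl (.ofA _) (.ofT _)).1 hn.symm)
  · exact fun hn => hc.T_anticomplete_C _ _ ((hr (.ofT _) (.ofC _)).1 hn)
  · exact fun hn => hc.stable_T _ _ ((hl (.ofT _) (.ofT _)).1 hn)

theorem VertABCLT.eq_of_toRight_eq {x y : VertABCLT A B C L T} (h : x.toRight = y.toRight)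
    (hA : x.part = .A → y.part = .A → x = y) : x = y := by
  cases x <;> cases y <;> simp_all [VertABCLT.toRight, VertABCLT.part]

theorem VertABCLT.eq_of_toLeft_eq {x y : VertABCLT A B C L T} (h : x.toLeft = y.toLeft)
    (hx : x.part ≠ .B) (hy : y.part ≠ .B) (hC : x.part = .C → y.part = .C → x = y) : x = y := by
  cases x <;> cases y <;> simp_all [VertABCLT.toLeft, VertABCLT.part]

/-- A vertex of `A` and the vertex `a` see `B`, `C` and `T` alike; only an edge from `A` to `L` can
be lost. -/
theorem IsUnification.adj_toRight (h : IsUnification G₁ G₂ G) {x y : VertABCLT A B C L T}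
    (hA : x.part = .A → y.part = .A → x = y) (hx : x.part = .A → y.part = .L → ¬ G.Adj x y)
    (hy : y.part = .A → x.part = .L → ¬ G.Adj y x) :
    G₂.Adj x.toRight y.toRight ↔ G.Adj x y := by
  have hc := h.composable
  have aB := hc.a_complete_B
  have aC := hc.a_anticomplete_C
  have aL := hc.a_anticomplete_L
  have aT := hc.a_anticomplete_T
  have hcomp := h.compatible x y
  rw [G.adj_comm] at hy
  cases x <;> cases y <;> simp only [VertABCLT.toRight, VertABCLT.part, Part.compatible,
    ← h.adj_right, VertBCLT.incl] at * <;> simp_all [SimpleGraph.adj_comm _ (some _) none]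

/-- A vertex of `C` and the vertex `c` see `A`, `L` and `T` alike. A vertex of `B` is complete to
`A` while `c` is anti-complete to it, hence the exclusion of `B`. -/
theorem IsUnification.adj_toLeft (h : IsUnification G₁ G₂ G) {x y : VertABCLT A B C L T}
    (hx : x.part ≠ .B) (hy : y.part ≠ .B) (hC : x.part = .C → y.part = .C → x = y) :
    G₁.Adj x.toLeft y.toLeft ↔ G.Adj x y := by
  have hc := h.composable
  have cL := hc.c_complete_L
  have cA := hc.c_anticomplete_A
  have cT := hc.c_anticomplete_T
  have hcomp := h.compatible x y
  cases x <;> cases y <;> simp only [VertABCLT.toLeft, VertABCLT.part, Part.compatible,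
    ← h.adj_left, VertALT.incl] at * <;> simp_all [SimpleGraph.adj_comm _ (some _) none]

theorem IsUnification.isP5HouseFree (h : IsUnification G₁ G₂ G)
    (h₁ : IsP5HouseFree G₁) (h₂ : IsP5HouseFree G₂) : IsP5HouseFree G := by
  classical
  rw [isP5HouseFree_iff]
  rintro H hH ⟨f⟩
  have key := hH.labelling (fun i => (f i).part) fun i j hij b hb => by
    convert h.compatible (f i) (f j) (f.injective.ne hij)
    rw [Bool.eq_iff_iff, hb, decide_eq_true_eq, f.map_adj_iff]
  have toRight (hA : ∀ i j, (f i).part = .A → (f j).part = .A → i = j)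
      (hL : ∀ i j, (f i).part = .A → (f j).part = .L → ¬ H.Adj i j) : False := by
    refine isP5HouseFree_iff.1 h₂ H hH (isIndContained_of_map (fun i => (f i).toRight) ?_ ?_)
    · exact fun i j hij => f.injective
        (VertABCLT.eq_of_toRight_eq hij fun hi hj => congrArg f (hA i j hi hj))
    · intro i j
      rw [← f.map_adj_iff]
      exact h.adj_toRight (fun hi hj => congrArg f (hA i j hi hj))
        (fun hi hj => by rw [f.map_adj_iff]; exact hL i j hi hj)
        (fun hi hj => by rw [f.map_adj_iff]; exact hL j i hi hj)
  rcases key with hA | ⟨hB, hC⟩ | ⟨hA, hL⟩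
  · exact toRight (fun i j hi => absurd hi (hA i)) (fun i j hi => absurd hi (hA i))
  · refine isP5HouseFree_iff.1 h₁ H hH (isIndContained_of_map (fun i => (f i).toLeft) ?_ ?_)
    · exact fun i j hij => f.injective
        (VertABCLT.eq_of_toLeft_eq hij (hB i) (hB j) fun hi hj => congrArg f (hC i j hi hj))
    · intro i j
      rw [← f.map_adj_iff]
      exact h.adj_toLeft (hB i) (hB j) fun hi hj => congrArg f (hC i j hi hj)
  · exact toRight hA hL

end

/-! ### The graphs in the class are free of the two graphs -/

theorem IsSplitGraph.compl {V : Type*} {G : SimpleGraph V} (h : IsSplitGraph G) :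
    IsSplitGraph Gᶜ := by
  obtain ⟨K, S, hKS, hd, hK, hS⟩ := h
  refine ⟨S, K, by rwa [Set.union_comm], hd.symm, ?_, ?_⟩
  · simpa using hS
  · simpa using hK

/-- The two end edges of the path form a 2K₂: each has an end in the clique, and these two ends are
not adjacent. -/
theorem IsSplitGraph.isFree_P5 {V : Type*} {G : SimpleGraph V} (h : IsSplitGraph G) :
    IsFree P5 G := by
  rintro ⟨f⟩
  obtain ⟨K, S, hKS, hd, hK, hS⟩ := h
  have clique : ∀ i j, i ≠ j → ¬ P5.Adj i j → ¬ (f i ∈ K ∧ f j ∈ K) := fun i j hij hn hk =>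
    hn (f.map_adj_iff.1 (hK hk.1 hk.2 (f.injective.ne hij)))
  have edge : ∀ i j, P5.Adj i j → f i ∈ K ∨ f j ∈ K := by
    intro i j hij
    have hm : ∀ x, x ∈ K ∪ S := fun x => hKS ▸ Set.mem_univ x
    rcases hm (f i) with h | h
    · exact .inl h
    rcases hm (f j) with h' | h'
    · exact .inr h'
    exact absurd (f.map_adj_iff.2 hij) (hS h h' (f.injective.ne hij.ne))
  have h1 := edge 0 1 (by decide)
  have h2 := edge 3 4 (by decide)
  have := clique 0 3 (by decide) (by decide)
  have := clique 0 4 (by decide) (by decide)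
  have := clique 1 3 (by decide) (by decide)
  have := clique 1 4 (by decide) (by decide)
  tauto

theorem IsSplitGraph.isP5HouseFree {V : Type*} {G : SimpleGraph V} (h : IsSplitGraph G) :
    IsP5HouseFree G :=
  ⟨h.isFree_P5, fun hn => h.compl.isFree_P5 (by simpa using compl_isIndContained_compl.2 hn)⟩

/-- A copy would use all five vertices and so be 2-regular, whereas an end of the path has degree 1,
and degree 3 in the complement. -/
theorem IsPentagon.isP5HouseFree {V : Type*} {G : SimpleGraph V} (h : IsPentagon G) :
    IsP5HouseFree G := by
  obtain ⟨e⟩ := h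
  refine IsP5HouseFree.of_embedding e.toEmbedding (isP5HouseFree_iff.2 ?_)
  rintro H hH ⟨f⟩
  classical
  have hs : Function.Bijective f := Finite.injective_iff_bijective.1 f.injective
  have hdeg : ∀ i, H.degree i = 2 := by
    intro i
    have : H ≃g cycleGraph 5 := ⟨Equiv.ofBijective f hs, f.map_adj_iff⟩
    rw [← this.degree_eq i]
    exact cycleGraph_degree_three_le
  have h3 : ∃ i, H.degree i ≠ 2 := by
    rcases hH with rfl | rfl
    · refine ⟨0, ?_⟩
      convert (by decide : P5.degree 0 ≠ 2)
    · refine ⟨0, ?_⟩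
      convert (by decide : P5ᶜ.degree 0 ≠ 2)
  exact h3.elim fun i hi => hi (hdeg i)

theorem Obtained.isP5HouseFree {V : Type u} {G : SimpleGraph V} (h : Obtained G) :
    IsP5HouseFree G := by
  induction h with
  | pentagon h => exact h.isP5HouseFree
  | split h => exact h.isP5HouseFree
  | iso e _ ih => exact ih.of_embedding e.symm.toEmbedding
  | substitution h _ _ ih₁ ih₂ => exact h.isP5HouseFree ih₁ ih₂
  | unification h _ _ ih₁ ih₂ => exact h.isP5HouseFree ih₁ ih₂
  | unificationCompl h _ _ ih₁ ih₂ => exact isP5HouseFree_compl_iff.1 (h.isP5HouseFree ih₁ ih₂)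

/-! ### Homogeneous sets, connected sets and divides -/

/-- No vertex outside `S` has both a neighbor and a non-neighbor in `S`. -/
def IsHomogeneous {V : Type*} (G : SimpleGraph V) (S : Set V) : Prop :=
  ∀ v ∉ S, (∀ s ∈ S, G.Adj v s) ∨ ∀ s ∈ S, ¬ G.Adj v s

/-- Every homogeneous set with at least two vertices is the whole vertex set. -/
def IsPrimeGraph {V : Type*} (G : SimpleGraph V) : Prop :=
  ∀ S : Set V, IsHomogeneous G S → S.Nontrivial → S = Set.univ

/-- `S` induces a connected (or null) subgraph: every proper nonempty part of `S` sends an edge to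
the rest of `S`. -/
def IsConn {V : Type*} (G : SimpleGraph V) (S : Set V) : Prop :=
  ∀ U ⊆ S, U.Nonempty → (S \ U).Nonempty → ∃ u ∈ U, ∃ v ∈ S \ U, G.Adj u v

/-- `x` is a vertex outside `A` with a neighbor and a non-neighbor in `A`. -/
def Mixed {V : Type*} (G : SimpleGraph V) (A : Set V) (x : V) : Prop :=
  x ∉ A ∧ (∃ a ∈ A, G.Adj x a) ∧ ∃ a ∈ A, ¬ G.Adj x a

/-- `x` is a vertex outside `A` without neighbors in `A`. -/
def Remote {V : Type*} (G : SimpleGraph V) (A : Set V) (x : V) : Prop :=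
  x ∉ A ∧ ∀ a ∈ A, ¬ G.Adj x a

/-- The set `A` is the first part of a partition which exhibits `G` as a split graph unification
of smaller graphs. -/
structure IsDivide {V : Type*} (G : SimpleGraph V) (A : Set V) : Prop where
  nontrivial : A.Nontrivial
  clique : ∀ x y, Mixed G A x → Mixed G A y → x ≠ y → G.Adj x y
  complete : ∀ x b, Mixed G A x → (∀ a ∈ A, G.Adj b a) → G.Adj x b
  isolated : ∀ v x, Remote G A v → Mixed G A x → ¬ G.Adj v x → ∀ w, Remote G A w → ¬ G.Adj v w
  two : ∃ c d, c ≠ d ∧ (Remote G A c ∧ ∀ x, Mixed G A x → G.Adj c x) ∧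
    (Remote G A d ∧ ∀ x, Mixed G A x → G.Adj d x)

section

variable {V : Type*} {G : SimpleGraph V}

theorem IsHomogeneous.compl {S : Set V} (h : IsHomogeneous G S) : IsHomogeneous Gᶜ S := by
  intro v hv
  rcases h v hv with h | h
  · exact .inr fun s hs hn => hn.2 (h s hs)
  · exact .inl fun s hs => ⟨fun e => hv (e ▸ hs), h s hs⟩

theorem IsPrimeGraph.compl (h : IsPrimeGraph G) : IsPrimeGraph Gᶜ := fun S hS =>
  h S (by simpa using hS.compl)

theorem IsPrimeGraph.exists_mixed (h : IsPrimeGraph G) {S : Set V} (hS : S.Nontrivial) {v : V}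
    (hv : v ∉ S) : ∃ x, Mixed G S x := by
  by_contra! hn
  refine hv ((h S ?_ hS) ▸ Set.mem_univ v)
  intro x hx
  by_contra! hc
  exact hn x ⟨hx, hc.2, hc.1⟩

/-- Connectedness gives an edge between the neighbors and the non-neighbors of `x` in `S`. -/
theorem IsConn.exists_adj_of_mixed {S : Set V} (hS : IsConn G S) {x : V} (hx : Mixed G S x) :
    ∃ a ∈ S, ∃ b ∈ S, G.Adj x a ∧ ¬ G.Adj x b ∧ G.Adj a b := by
  obtain ⟨hxS, ⟨a, ha, hxa⟩, b, hb, hxb⟩ := hx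
  obtain ⟨u, hu, v, hv, huv⟩ := hS {s ∈ S | G.Adj x s} (fun s hs => hs.1) ⟨a, ha, hxa⟩
    ⟨b, hb, fun h => hxb h.2⟩
  exact ⟨u, hu.1, v, hv.1, hu.2, fun h => hv.2 ⟨hv.1, h⟩, huv⟩

theorem isConn_pair {a b : V} (h : G.Adj a b) : IsConn G {a, b} := by
  intro U hU ⟨u, hu⟩ ⟨v, hv, hvU⟩
  refine ⟨u, hu, v, ⟨hv, hvU⟩, ?_⟩
  rcases hU hu with rfl | rfl <;> rcases hv with rfl | rfl
  · exact absurd hu hvU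
  · exact h
  · exact h.symm
  · exact absurd hu hvU

theorem IsConn.insert {S : Set V} (hS : IsConn G S) {x a : V} (ha : a ∈ S) (hxa : G.Adj x a) :
    IsConn G (insert x S) := by
  intro U hU ⟨u, hu⟩ ⟨v, hv, hvU⟩
  by_cases h1 : (U ∩ S).Nonempty
  · by_cases h2 : (S \ (U ∩ S)).Nonempty
    · obtain ⟨u, hu, v, hv, huv⟩ := hS (U ∩ S) Set.inter_subset_right h1 h2
      exact ⟨u, hu.1, v, ⟨.inr hv.1, fun h => hv.2 ⟨h, hv.1⟩⟩, huv⟩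
    · have hSU : ∀ s ∈ S, s ∈ U := fun s hs => by
        by_contra hsU
        exact h2 ⟨s, hs, fun h => hsU h.1⟩
      rcases hv with rfl | hv
      · exact ⟨a, hSU a ha, v, ⟨.inl rfl, hvU⟩, hxa.symm⟩
      · exact absurd (hSU v hv) hvU
  · have hUS : ∀ s ∈ S, s ∉ U := fun s hs hsU => h1 ⟨s, hsU, hs⟩
    rcases hU hu with rfl | hu'
    · exact ⟨u, hu, a, ⟨.inr ha, hUS a ha⟩, hxa⟩
    · exact absurd hu (hUS u hu')

/-- The component is a minimal set containing `x` that sends no edge to the rest of `X`; a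
separation of it would yield a smaller one. -/
theorem exists_isConn_component [Finite V] (G : SimpleGraph V) {X : Set V} {x : V} (hx : x ∈ X) :
    ∃ Q ⊆ X, x ∈ Q ∧ (∀ q ∈ Q, ∀ y ∈ X \ Q, ¬ G.Adj q y) ∧ IsConn G Q := by
  obtain ⟨Q, hQ⟩ := (Set.toFinite {Q : Set V | Q ⊆ X ∧ x ∈ Q ∧ ∀ q ∈ Q, ∀ y ∈ X \ Q,
    ¬ G.Adj q y}).exists_minimal ⟨X, le_rfl, hx, fun q _ y hy => absurd hy.1 hy.2⟩
  obtain ⟨hQX, hxQ, hcl⟩ := hQ.prop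
  refine ⟨Q, hQX, hxQ, hcl, ?_⟩
  intro U hU hne ⟨v, hv, hvU⟩
  by_contra! hn
  by_cases hxU : x ∈ U
  · exact hvU (hQ.le_of_le (y := U) ⟨hU.trans hQX, hxU, fun q hq y hy hqy => by
      by_cases hyQ : y ∈ Q
      · exact hn q hq y ⟨hyQ, hy.2⟩ hqy
      · exact hcl q (hU hq) y ⟨hy.1, hyQ⟩ hqy⟩ hU hv)
  · obtain ⟨u, hu⟩ := hne
    refine (hQ.le_of_le (y := Q \ U) ⟨Set.sdiff_subset.trans hQX, ⟨hxQ, hxU⟩, fun q hq y hy hqy => ?_⟩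
      Set.sdiff_subset (hU hu)).2 hu
    by_cases hyQ : y ∈ Q
    · by_cases hyU : y ∈ U
      · exact hn y hyU q hq hqy.symm
      · exact hy.2 ⟨hyQ, hyU⟩
    · exact hcl q hq.1 y ⟨hy.1, hyQ⟩ hqy

theorem mixed_compl_iff {S : Set V} {x : V} : Mixed Gᶜ S x ↔ Mixed G S x := by
  have key : ∀ s ∈ S, x ∉ S → (Gᶜ.Adj x s ↔ ¬ G.Adj x s) := fun s hs hx =>
    ⟨fun h => h.2, fun h => ⟨fun e => hx (e ▸ hs), h⟩⟩
  constructor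
  · rintro ⟨hx, ⟨a, ha, hxa⟩, b, hb, hxb⟩
    exact ⟨hx, ⟨b, hb, by rwa [key b hb hx, not_not] at hxb⟩, a, ha, (key a ha hx).1 hxa⟩
  · rintro ⟨hx, ⟨a, ha, hxa⟩, b, hb, hxb⟩
    exact ⟨hx, ⟨b, hb, (key b hb hx).2 hxb⟩, a, ha, by rwa [key a ha hx, not_not]⟩

theorem remote_compl_iff {S : Set V} {x : V} :
    Remote Gᶜ S x ↔ x ∉ S ∧ ∀ s ∈ S, G.Adj x s := by
  refine and_congr_right fun hx => forall₂_congr fun s hs => ?_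
  have : x ≠ s := fun e => hx (e ▸ hs)
  simp [this]

theorem IsConn.exists_not_adj_of_mixed {S : Set V} (hS : IsConn Gᶜ S) {x : V} (hx : Mixed G S x) :
    ∃ a ∈ S, ∃ b ∈ S, G.Adj x a ∧ ¬ G.Adj x b ∧ a ≠ b ∧ ¬ G.Adj a b := by
  obtain ⟨b, hb, a, ha, hxb, hxa, hba⟩ := hS.exists_adj_of_mixed (mixed_compl_iff.2 hx)
  refine ⟨a, ha, b, hb, ?_, hxb.2, hba.1.symm, fun h => hba.2 h.symm⟩
  by_contra hn
  exact hxa ⟨fun e => hx.1 (e ▸ ha), hn⟩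

/-- The house in its usual drawing: the square `p q r s` with roof `v` over the edge `p q`. -/
theorem IsP5HouseFree.no_roof (hG : IsP5HouseFree G) {p q r s v : V} (hpq : G.Adj p q)
    (hqr : G.Adj q r) (hrs : G.Adj r s) (hsp : G.Adj s p) (hpr : ¬ G.Adj p r) (hqs : ¬ G.Adj q s)
    (hvp : G.Adj v p) (hvq : G.Adj v q) (hvr : ¬ G.Adj v r) (hvs : ¬ G.Adj v s) : False :=
  hG.no_house (a := p) (b := r) (c := v) (d := s) (e := q) hpr (fun h => hvr h.symm) hvs
    (fun h => hqs h.symm) hvp.symm hsp.symm hpq hrs hqr.symm hvq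

/-- The hypotheses on the four vertices say that they induce 2K₂, which makes the family over which
`A` is maximized nonempty. -/
theorem exists_divide [Finite V] (hG : IsP5HouseFree G) (hp : IsPrimeGraph G) {a₀ a₁ c₀ c₁ : V}
    (ha : G.Adj a₀ a₁) (hc : G.Adj c₀ c₁) (h00 : ¬ G.Adj c₀ a₀) (h01 : ¬ G.Adj c₀ a₁)
    (h10 : ¬ G.Adj c₁ a₀) (h11 : ¬ G.Adj c₁ a₁) :
    (∃ A, IsDivide G A) ∨ ∃ A, IsDivide Gᶜ A := by
  obtain ⟨A, hA⟩ := (Set.toFinite {S : Set V | IsConn G S ∧ S.Nontrivial ∧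
    ∃ c d, Remote G S c ∧ Remote G S d ∧ G.Adj c d}).exists_maximal ⟨{a₀, a₁}, isConn_pair ha,
      Set.nontrivial_pair ha.ne, c₀, c₁, ⟨by rintro (rfl | rfl); exacts [h01 ha, h00 ha.symm],
        by rintro _ (rfl | rfl) <;> assumption⟩, ⟨by rintro (rfl | rfl); exacts [h11 ha, h10 ha.symm],
        by rintro _ (rfl | rfl) <;> assumption⟩, hc⟩
  obtain ⟨hconn, hnt, hedge⟩ := hA.prop
  -- the neighbors of `A`, the non-isolated and the isolated vertices among those remote from `A`
  obtain ⟨X, hX⟩ : ∃ X : Set V, ∀ x, x ∈ X ↔ x ∉ A ∧ ∃ a ∈ A, G.Adj x a := ⟨{x | _}, fun _ => .rfl⟩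
  obtain ⟨C, hC⟩ : ∃ C : Set V, ∀ c, c ∈ C ↔ Remote G A c ∧ ∃ d, Remote G A d ∧ G.Adj c d :=
    ⟨{x | _}, fun _ => .rfl⟩
  have hC' : ∀ c ∈ C, ∃ d ∈ C, G.Adj c d := fun c hc => by
    obtain ⟨h, d, hd, hcd⟩ := (hC c).1 hc
    exact ⟨d, (hC d).2 ⟨hd, c, h, hcd.symm⟩, hcd⟩
  have hCnt : C.Nontrivial := by
    obtain ⟨c, d, h1, h2, h⟩ := hedge
    exact ⟨c, (hC c).2 ⟨h1, d, h2, h⟩, d, (hC d).2 ⟨h2, c, h1, h.symm⟩, h.ne⟩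
  have hAC : ∀ a ∈ A, ∀ c ∈ C, ¬ G.Adj c a := fun a ha c hc => ((hC c).1 hc).1.2 a ha
  have cover : ∀ v, v ∈ A ∨ v ∈ X ∨ v ∈ C ∨ (Remote G A v ∧ ∀ w, Remote G A w → ¬ G.Adj v w) := by
    intro v
    by_cases h1 : v ∈ A
    · exact .inl h1
    by_cases h2 : v ∈ X
    · exact .inr (.inl h2)
    have h3 : Remote G A v := ⟨h1, fun a ha h => h2 ((hX v).2 ⟨h1, a, ha, h⟩)⟩
    by_cases h4 : v ∈ C
    · exact .inr (.inr (.inl h4))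
    · exact .inr (.inr (.inr ⟨h3, fun w hw h => h4 ((hC v).2 ⟨h3, w, hw, h⟩)⟩))
  -- If `x` missed both ends of an edge of `C`, then `insert x A` would contradict the maximality of
  -- `A`.
  have touch : ∀ x ∈ X, ∀ c d, c ∈ C → d ∈ C → G.Adj c d → G.Adj x c ∨ G.Adj x d := by
    intro x hx c d hc hd hcd
    by_contra! hn
    obtain ⟨hxA, a, ha, hxa⟩ := (hX x).1 hx
    have hr : ∀ c ∈ C, ¬ G.Adj x c → Remote G (insert x A) c := by
      intro c hc hxc
      have := ((hC c).1 hc).1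
      refine ⟨?_, ?_⟩
      · rintro (rfl | h)
        exacts [this.2 a ha hxa, this.1 h]
      · rintro b (rfl | h)
        exacts [fun h => hxc h.symm, this.2 b h]
    exact hxA (hA.le_of_ge (y := insert x A) ⟨hconn.insert ha hxa, hnt.mono (Set.subset_insert _ _),
      c, d, hr c hc hn.1, hr d hd hn.2, hcd⟩ (Set.subset_insert _ _) (.inl rfl))
  have hMX : ∀ x, Mixed G A x → x ∈ X := fun x hx => (hX x).2 ⟨hx.1, hx.2.1⟩
  have hXM : ∀ x ∈ X, ¬ Mixed G A x → ∀ a ∈ A, G.Adj x a := by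
    intro x hx hm a ha
    by_contra hn
    exact hm ⟨((hX x).1 hx).1, ((hX x).1 hx).2, a, ha, hn⟩
  -- mixed vertices are complete to `C`
  have hMC : ∀ x, Mixed G A x → ∀ c ∈ C, G.Adj x c := by
    intro x hx c hc
    by_contra hn
    obtain ⟨a, ha, b, hb, hxa, hxb, hab⟩ := hconn.exists_adj_of_mixed hx
    obtain ⟨d, hd, hcd⟩ := hC' c hc
    have hxd := (touch x (hMX x hx) c d hc hd hcd).resolve_left hn
    have h1 := hAC a ha c hc
    have h2 := hAC b hb c hc
    have h3 := hAC a ha d hd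
    have h4 := hAC b hb d hd
    rw [G.adj_comm] at h1 h2 h3 h4
    -- The induced path is `b a x d c`.
    exact hG.no_path hab.symm hxa.symm hxd hcd.symm (fun h => hxb h.symm) h4 h2 h3 h1 hn
  -- mixed vertices are complete to the other neighbors of `A`
  have hMB : ∀ x, Mixed G A x → ∀ y ∈ X, ¬ Mixed G A y → G.Adj x y := by
    intro x hx y hy hm
    by_contra hn
    obtain ⟨a, ha, b, hb, hxa, hxb, hab⟩ := hconn.exists_adj_of_mixed hx
    obtain ⟨c, hc⟩ := hCnt.nonempty
    obtain ⟨d, hd, hcd⟩ := hC' c hc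
    obtain ⟨e, he, hye⟩ : ∃ e ∈ C, G.Adj y e := by
      rcases touch y hy c d hc hd hcd with h | h
      exacts [⟨c, hc, h⟩, ⟨d, hd, h⟩]
    have hxe := hMC x hx e he
    -- The square is `a y e x`, with roof `b` over `a y`.
    exact hG.no_roof (hXM y hy hm a ha).symm hye hxe.symm hxa (fun h => hAC a ha e he h.symm)
      (fun h => hn h.symm) hab.symm (hXM y hy hm b hb).symm (fun h => hAC b hb e he h.symm)
      fun h => hxb h.symm
  -- some neighbor of `A` is not complete to `C`
  obtain ⟨y, hyX, c', hc'C, hyc'⟩ : ∃ y ∈ X, ∃ c ∈ C, ¬ G.Adj y c := by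
    obtain ⟨a, ha⟩ := hnt.nonempty
    -- Primeness, applied to `C`, gives a vertex mixed on `C`; only vertices of `X` can be.
    obtain ⟨y, hy, ⟨c, hc, hyc⟩, d, hd, hyd⟩ := hp.exists_mixed hCnt (v := a)
      (fun h => ((hC a).1 h).1.1 ha)
    refine ⟨y, ?_, d, hd, hyd⟩
    rcases cover y with h | h | h | h
    · exact absurd hyc.symm (hAC y h c hc)
    · exact h
    · exact absurd h hy
    · exact absurd hyc (h.2 c ((hC c).1 hc).1)
  have hyM : ¬ Mixed G A y := fun h => hyc' (hMC y h c' hc'C)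
  obtain ⟨m, hm⟩ : ∃ m, Mixed G A m :=
    hp.exists_mixed hnt (v := c') ((hC c').1 hc'C).1.1
  by_cases hclique : ∀ x y, Mixed G A x → Mixed G A y → x ≠ y → G.Adj x y
  · left
    refine ⟨A, hnt, hclique, ?_, ?_, ?_⟩
    · intro x b hx hb
      obtain ⟨a, ha⟩ := hnt.nonempty
      refine hMB x hx b ((hX b).2 ⟨fun h => (hb b h).ne rfl, a, ha, hb a ha⟩) ?_
      rintro ⟨-, -, d, hd, hbd⟩
      exact hbd (hb d hd)
    · intro v x hv hx hvx w hw hvw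
      exact hvx (hMC x hx v ((hC v).2 ⟨hv, w, hw, hvw⟩)).symm
    · obtain ⟨c, hc, d, hd, hcd⟩ := hCnt
      exact ⟨c, d, hcd, ⟨((hC c).1 hc).1, fun x hx => (hMC x hx c hc).symm⟩, ((hC d).1 hd).1,
        fun x hx => (hMC x hx d hd).symm⟩
  right
  push Not at hclique
  obtain ⟨x₀, y₀, hx₀, hy₀, hne₀, hn₀⟩ := hclique
  -- non-adjacent neighbors of `A` have the same neighbors in `A` and in `C`
  have twinA : ∀ x ∈ X, ∀ x' ∈ X, ¬ G.Adj x x' → ∀ a ∈ A, G.Adj x a → G.Adj x' a := by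
    intro x hx x' hx' hxx' a ha hxa
    by_contra hn
    have hm' : Mixed G A x' := ⟨((hX x').1 hx').1, ((hX x').1 hx').2, a, ha, hn⟩
    have hm : Mixed G A x := by
      by_contra h
      exact hxx' (hMB x' hm' x hx h).symm
    -- The square is `x y x' c'`, with roof `a` over `x y`; it exists because `y` is complete to `A`
    -- but misses `c'`.
    exact hG.no_roof (hMB x hm y hyX hyM) (hMB x' hm' y hyX hyM).symm (hMC x' hm' c' hc'C)
      (hMC x hm c' hc'C).symm hxx' hyc' hxa.symm (hXM y hyX hyM a ha).symm (fun h => hn h.symm)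
      (fun h => hAC a ha c' hc'C h.symm)
  have twinC : ∀ x ∈ X, ∀ x' ∈ X, ¬ G.Adj x x' → ∀ c ∈ C, G.Adj x c → G.Adj x' c := by
    intro x hx x' hx' hxx' c hc hxc
    by_contra hn
    have hm' : ¬ Mixed G A x' := fun h => hn (hMC x' h c hc)
    have hm : ¬ Mixed G A x := fun h => hxx' (hMB x h x' hx' hm')
    obtain ⟨-, -, b, hb, hmb⟩ := id ‹Mixed G A m›
    -- The square is `x m x' b`, with roof `c` over `x m`, where `b` is a non-neighbor of `m` in
    -- `A`.
    exact hG.no_roof (hMB m ‹_› x hx hm).symm (hMB m ‹_› x' hx' hm') (hXM x' hx' hm' b hb)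
      (hXM x hx hm b hb).symm hxx' hmb hxc.symm (hMC m ‹_› c hc).symm (fun h => hn h.symm)
      (hAC b hb c hc)
  -- Otherwise `z x p x'` is a square with roof `t` over `z x`.
  have forcing : ∀ {x x' t z p : V}, G.Adj t x → ¬ G.Adj t x' → ¬ G.Adj x x' → G.Adj z x →
      G.Adj z x' → G.Adj p x → G.Adj p x' → G.Adj z t → ¬ G.Adj p t → G.Adj p z := by
    intro x x' t z p h1 h2 h3 h4 h5 h6 h7 h8 h9
    by_contra h
    exact hG.no_house (a := z) (b := p) (c := t) (d := x') (e := x) (fun e => h e.symm) h9 h2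
      (fun e => h3 e.symm) h8 h5 h4 h7 h6 h1
  -- a nontrivial co-component of `X` with as many common neighbors as possible
  obtain ⟨P, hP⟩ : ∃ P : Set V → Prop, ∀ Q, P Q ↔ Q ⊆ X ∧ Q.Nontrivial ∧ IsConn Gᶜ Q ∧
      ∀ q ∈ Q, ∀ y ∈ X \ Q, G.Adj q y := ⟨_, fun _ => .rfl⟩
  have hcomp : ∀ x ∈ X, ∀ y ∈ X, x ≠ y → ¬ G.Adj x y → ∃ Q, P Q ∧ x ∈ Q ∧ y ∈ Q := by
    intro x hx y hy hxy hn
    obtain ⟨Q, hQX, hxQ, hcl, hconnQ⟩ := exists_isConn_component Gᶜ hx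
    have hcl' : ∀ q ∈ Q, ∀ y ∈ X \ Q, G.Adj q y := by
      intro q hq y hy
      by_contra h
      exact hcl q hq y hy ⟨fun e => hy.2 (e ▸ hq), h⟩
    have hyQ : y ∈ Q := by
      by_contra h
      exact hn (hcl' x hxQ y ⟨hy, h⟩)
    exact ⟨Q, (hP Q).2 ⟨hQX, ⟨x, hxQ, y, hyQ, hxy⟩, hconnQ, hcl'⟩, hxQ, hyQ⟩
  obtain ⟨Q₀, hQ₀, -, -⟩ := hcomp x₀ (hMX _ hx₀) y₀ (hMX _ hy₀) hne₀ hn₀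
  -- Only common neighbors that are isolated among the vertices remote from `A` count, and they are
  -- compared by inclusion.
  obtain ⟨Q, hQ⟩ := (Set.toFinite {Q | P Q}).exists_maximalFor
    (fun Q => {t | (Remote G A t ∧ ∀ w, Remote G A w → ¬ G.Adj t w) ∧ ∀ q ∈ Q, G.Adj t q}) _
    ⟨Q₀, hQ₀⟩
  obtain ⟨hQX, hQnt, hQconn, hQcl⟩ := (hP Q).1 hQ.prop
  have hQA : ∀ a ∈ A, ¬ Mixed G Q a := by
    intro a ha h
    obtain ⟨x, hx, x', hx', h1, h2, -, h3⟩ := hQconn.exists_not_adj_of_mixed h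
    exact h2 (twinA x (hQX hx) x' (hQX hx') h3 a ha h1.symm).symm
  have hQC : ∀ c ∈ C, ¬ Mixed G Q c := by
    intro c hc h
    obtain ⟨x, hx, x', hx', h1, h2, -, h3⟩ := hQconn.exists_not_adj_of_mixed h
    exact h2 (twinC x (hQX hx) x' (hQX hx') h3 c hc h1.symm).symm
  -- By the twin properties, vertices of `A` and `C` are not mixed on `Q`, and the rest of `X` is
  -- complete to `Q`.
  have hQT : ∀ t, Mixed G Q t → Remote G A t ∧ ∀ w, Remote G A w → ¬ G.Adj t w := by
    intro t ht
    rcases cover t with h | h | h | h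
    · exact absurd ht (hQA t h)
    · obtain ⟨htQ, -, q, hq, htq⟩ := ht
      exact absurd (hQcl q hq t ⟨h, htQ⟩).symm htq
    · exact absurd ht (hQC t h)
    · exact h
  have hTX : ∀ t v, Mixed G Q t → G.Adj v t → v ∈ X := by
    intro t v ht hvt
    have := hQT t ht
    rcases cover v with h | h | h | h
    · exact absurd hvt.symm (this.1.2 v h)
    · exact h
    · exact absurd hvt.symm (this.2 v ((hC v).1 h).1)
    · exact absurd hvt.symm (this.2 v h.1)
  refine ⟨Q, hQnt, ?_, ?_, ?_, ?_⟩
  · intro s t hs ht hst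
    rw [mixed_compl_iff] at hs ht
    exact ⟨hst, (hQT s hs).2 t (hQT t ht).1⟩
  · intro t b ht hb
    rw [mixed_compl_iff] at ht
    obtain ⟨q, hq⟩ := hQnt.nonempty
    refine ⟨?_, fun h => ?_⟩
    · rintro rfl
      obtain ⟨-, ⟨q, hq, htq⟩, -⟩ := ht
      exact (hb q hq).2 htq
    · have hbX := hTX t b ht h.symm
      have hbQ : b ∉ Q := fun h => (hb b h).ne rfl
      exact (hb q hq).2 (hQcl q hq b ⟨hbX, hbQ⟩).symm
  -- In `G`, both `v` and `w` are complete to `Q`, `v` is adjacent to `t`, and `v`, `w` are not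
  -- adjacent. They then lie in another co-component `Z` of `X`, and `t` will be complete to `Z`.
  · intro v t hv ht hvt w hw hvw
    rw [mixed_compl_iff] at ht
    rw [remote_compl_iff] at hv hw
    obtain ⟨x, hx, x', hx', htx, htx', -, hxx'⟩ := hQconn.exists_not_adj_of_mixed ht
    have hvt' : G.Adj v t := by
      by_contra h
      exact hvt ⟨fun e => htx' (e ▸ hv.2 x' hx'), h⟩
    have hwt : G.Adj w t := by
      by_contra h
      exact hvw.2 (forcing htx htx' hxx' (hv.2 x hx) (hv.2 x' hx') (hw.2 x hx) (hw.2 x' hx')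
        hvt' h).symm
    obtain ⟨Z, hZ, hvZ, hwZ⟩ := hcomp v (hTX t v ht hvt') w (hTX t w ht hwt) hvw.1 hvw.2
    obtain ⟨hZX, -, hZconn, -⟩ := (hP Z).1 hZ
    have hZQ : ∀ z ∈ Z, ∀ q ∈ Q, G.Adj z q := by
      have hd : ∀ z ∈ Z, z ∉ Q := by
        intro z hz hzQ
        obtain ⟨p, hp, r, hr, hpr⟩ := hZconn (Z ∩ Q) Set.inter_subset_left ⟨z, hz, hzQ⟩
          ⟨v, hvZ, fun h => hv.1 h.2⟩
        exact hpr.2 (hQcl p hp.2 r ⟨hZX hr.1, fun h => hr.2 ⟨hr.1, h⟩⟩)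
      exact fun z hz q hq => (hQcl q hq z ⟨hZX hz, hd z hz⟩).symm
    have htZ : ∀ z ∈ Z, G.Adj t z := by
      intro z hz
      by_contra h
      have htZ : t ∉ Z := fun h => htx' (hZQ t h x' hx')
      obtain ⟨p, hp, r, hr, htp, htr, -, hpr⟩ :=
        hZconn.exists_not_adj_of_mixed ⟨htZ, ⟨v, hvZ, hvt'.symm⟩, z, hz, h⟩
      exact hpr (forcing htx htx' hxx' (hZQ p hp x hx) (hZQ p hp x' hx') (hZQ r hr x hx)
        (hZQ r hr x' hx') htp.symm fun h => htr h.symm).symm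
    -- By `forcing`, every counted common neighbor of `Q` is one of `Z`; so is `t`, which is not
    -- complete to `Q`. This contradicts the choice of `Q`.
    refine htx' ((hQ.le_of_le hZ ?_ ⟨hQT t ht, htZ⟩).2 x' hx')
    rintro s ⟨hs, hsQ⟩
    exact ⟨hs, fun z hz => forcing htx htx' hxx' (hZQ z hz x hx) (hZQ z hz x' hx') (hsQ x hx)
      (hsQ x' hx') (htZ z hz).symm (hs.2 t (hQT t ht).1)⟩
  -- The two vertices are neighbors of `q` in `A` and in `C`. Not being mixed on `Q`, they are
  -- complete to it in `G`; lying outside `X`, they have no neighbor mixed on `Q`.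
  · obtain ⟨q, hq⟩ := hQnt.nonempty
    obtain ⟨-, a, ha, hqa⟩ := (hX q).1 (hQX hq)
    obtain ⟨e, he, hqe⟩ : ∃ e ∈ C, G.Adj q e := by
      obtain ⟨c, hc⟩ := hCnt.nonempty
      obtain ⟨d, hd, hcd⟩ := hC' c hc
      rcases touch q (hQX hq) c d hc hd hcd with h | h
      exacts [⟨c, hc, h⟩, ⟨d, hd, h⟩]
    have hCR := fun c hc => ((hC c).1 hc).1
    have good : ∀ v, v ∉ X → ¬ Mixed G Q v → G.Adj q v →
        Remote Gᶜ Q v ∧ ∀ x, Mixed Gᶜ Q x → Gᶜ.Adj v x := by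
      intro v hvX hvm hqv
      have hvQ : v ∉ Q := fun h => hvX (hQX h)
      refine ⟨remote_compl_iff.2 ⟨hvQ, fun s hs => ?_⟩, fun t ht => ?_⟩
      · by_contra h
        exact hvm ⟨hvQ, ⟨q, hq, hqv.symm⟩, s, hs, h⟩
      · rw [mixed_compl_iff] at ht
        exact ⟨fun e => hvm (e ▸ ht), fun h => hvX (hTX t v ht h)⟩
    refine ⟨a, e, fun h => (hCR e he).1 (h ▸ ha), good a (fun h => ((hX a).1 h).1 ha) (hQA a ha) hqa,
      good e (fun h => ?_) (hQC e he) hqe⟩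
    obtain ⟨-, b, hb, heb⟩ := (hX e).1 h
    exact (hCR e he).2 b hb heb

end

section

variable {V : Type*} {G : SimpleGraph V}

/-! ### Graphs without `2K₂` and `C₄` -/

/-- `G` has no two disjoint edges which induce `2K₂`. -/
def NoTwoEdges (G : SimpleGraph V) : Prop :=
  ∀ a b c d, G.Adj a b → G.Adj c d → ¬ G.Adj c a → ¬ G.Adj c b → ¬ G.Adj d a → ¬ G.Adj d b → False

/-- `G` has no induced cycle of length four. -/
def NoSquare (G : SimpleGraph V) : Prop :=
  ∀ a b c d, a ≠ c → b ≠ d → G.Adj a b → G.Adj b c → G.Adj c d → G.Adj d a → ¬ G.Adj a c →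
    ¬ G.Adj b d → False

/-- `a, b, c, d, e` are the consecutive vertices of an induced cycle of `G`. -/
structure IsFiveCycle (G : SimpleGraph V) (a b c d e : V) : Prop where
  ab : G.Adj a b
  bc : G.Adj b c
  cd : G.Adj c d
  de : G.Adj d e
  ea : G.Adj e a
  ac : ¬ G.Adj a c
  ad : ¬ G.Adj a d
  bd : ¬ G.Adj b d
  be : ¬ G.Adj b e
  ce : ¬ G.Adj c e

/-- Among the cliques of maximum size, let `K` have the largest degree sum. An edge outside `K`
leads to an induced 2K₂, C₄ or C₅. -/
theorem isSplitGraph_of_no_induced [Finite V] (h2 : NoTwoEdges G) (h4 : NoSquare G)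
    (h5 : ∀ a b c d e, ¬ IsFiveCycle G a b c d e) : IsSplitGraph G := by
  classical
  have := Fintype.ofFinite V
  obtain ⟨K, hK, hmax⟩ := Set.exists_max_image {K : Finset V | G.IsClique K}
    (fun K => toLex (K.card, ∑ v ∈ K, G.degree v)) (Set.toFinite _) ⟨∅, by simp⟩
  replace hK : G.IsClique K := hK
  have hcard : ∀ K' : Finset V, G.IsClique K' → K'.card ≤ K.card := fun K' h => by
    rcases Prod.Lex.toLex_le_toLex.1 (hmax K' h) with h | h
    exacts [h.le, h.1.le]
  have hdeg : ∀ K' : Finset V, G.IsClique K' → K'.card = K.card →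
      ∑ v ∈ K', G.degree v ≤ ∑ v ∈ K, G.degree v := fun K' h he => by
    rcases Prod.Lex.toLex_le_toLex.1 (hmax K' h) with h | h
    exacts [absurd he h.ne, h.2]
  have hnon : ∀ u ∉ K, ∃ x ∈ K, ¬ G.Adj u x := by
    intro u hu
    by_contra! h
    have := hcard (insert u K) (by
      rw [Finset.coe_insert]
      exact hK.insert fun b hb _ => h b hb)
    rw [Finset.card_insert_of_notMem hu] at this
    omega
  have aux : ∀ u v, u ∉ K → v ∉ K → G.Adj u v → (∀ x ∈ K, ¬ G.Adj u x → ¬ G.Adj v x) → False := by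
    intro u v hu hv huv hsub
    obtain ⟨x, hx, hux⟩ := hnon u hu
    have hvx := hsub x hx hux
    have huK : ∀ y ∈ K, y ≠ x → G.Adj u y := by
      intro y hy hyx
      by_contra h
      exact h2 x y u v (hK hx hy hyx.symm) huv hux h hvx (hsub y hy h)
    have hswap : G.IsClique (insert u (K.erase x) : Finset V) := by
      rw [Finset.coe_insert]
      refine (hK.subset (by simp)).insert fun b hb _ => ?_
      rw [Finset.mem_coe, Finset.mem_erase] at hb
      exact huK b hb.2 hb.1
    have hu' : u ∉ K.erase x := fun h => hu (Finset.mem_of_mem_erase h)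
    have hswapcard : (insert u (K.erase x)).card = K.card := by
      rw [Finset.card_insert_of_notMem hu', Finset.card_erase_add_one hx]
    obtain ⟨y, hy, hyx, hvy⟩ : ∃ y ∈ K, y ≠ x ∧ ¬ G.Adj v y := by
      by_contra! h
      have hv' : v ∉ insert u (K.erase x) := by
        rw [Finset.mem_insert, not_or]
        exact ⟨huv.ne', fun h => hv (Finset.mem_of_mem_erase h)⟩
      have := hcard (insert v (insert u (K.erase x))) (by
        rw [Finset.coe_insert]
        refine hswap.insert fun b hb _ => ?_
        rw [Finset.mem_coe, Finset.mem_insert, Finset.mem_erase] at hb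
        rcases hb with rfl | hb
        exacts [huv.symm, h b hb.2 hb.1])
      rw [Finset.card_insert_of_notMem hv', hswapcard] at this
      omega
    -- Replacing `x` by `u` keeps a maximum clique, so `u` has degree at most that of `x`. As `v` is
    -- adjacent to `u` but not to `x`, some `w` does the opposite.
    obtain ⟨w, hxw, huw⟩ : ∃ w, G.Adj x w ∧ ¬ G.Adj u w := by
      by_contra! h
      have h1 := hdeg _ hswap hswapcard
      rw [Finset.sum_insert hu', ← Finset.sum_erase_add _ _ hx, add_comm, add_le_add_iff_left] at h1
      refine absurd h1 (not_le.2 (Finset.card_lt_card ⟨fun w => by simpa using h w, fun hn => ?_⟩))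
      have := hn ((G.mem_neighborFinset u v).2 huv)
      exact hvx ((G.mem_neighborFinset x v).1 this).symm
    have hxy := hK hx hy hyx.symm
    have huy := huK y hy hyx
    have hvw : G.Adj v w := by
      by_contra h
      exact h2 x w u v hxw huv hux huw hvx h
    have hyw : ¬ G.Adj y w := by
      intro hyw
      exact h4 w v u y (fun e => hux (e ▸ hxw.symm)) (fun e => hvx (e ▸ hxy.symm)) hvw.symm huv.symm huy hyw
        (fun h => huw h.symm) hvy
    exact h5 x y u v w ⟨hxy, huy.symm, huv, hvw, hxw.symm, fun h => hux h.symm, fun h => hvx h.symm,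
      fun h => hvy h.symm, hyw, huw⟩
  refine ⟨K, (K : Set V)ᶜ, Set.union_compl_self _, disjoint_compl_right, hK, ?_⟩
  intro u hu v hv _ huv
  -- The non-neighborhoods of `u` and `v` in `K` are nested, since otherwise `u v x y` is an induced
  -- C₄.
  by_cases h : ∀ x ∈ K, ¬ G.Adj u x → ¬ G.Adj v x
  · exact aux u v hu hv huv h
  refine aux v u hv hu huv.symm fun y hy hvy huy => ?_
  push Not at h
  obtain ⟨x, hx, hux, hvx⟩ := h
  exact h4 u v x y (fun e => hu (by rwa [e])) (fun e => hv (by rwa [e])) huv hvx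
    (hK hx hy fun e => hux (e ▸ huy)) huy.symm hux hvy

/-- The five vertices form a homogeneous set. An outside vertex adjacent to one of them is adjacent
to an end of the opposite edge (no 2K₂), and adjacency to two at distance two gives the one between
(no C₄); together these reach all five. -/
theorem IsPrimeGraph.isPentagon (hp : IsPrimeGraph G) (h2 : NoTwoEdges G) (h4 : NoSquare G)
    {a b c d e : V} (h : IsFiveCycle G a b c d e) : IsPentagon G := by
  obtain ⟨ab, bc, cd, de, ea, ac, ad, bd, be, ce⟩ := h
  have key : ∀ i j : Fin 5, G.Adj (![a, b, c, d, e] i) (![a, b, c, d, e] j) ↔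
      (cycleGraph 5).Adj i j := by
    intro i j
    fin_cases i <;> fin_cases j <;>
      simp [cycleGraph_adj', ab, bc, cd, de, ea, ac, ad, bd, be, ce, ab.symm, bc.symm, cd.symm,
        de.symm, ea.symm, G.adj_comm c a, G.adj_comm d a, G.adj_comm d b, G.adj_comm e b,
        G.adj_comm e c] <;> decide
  have hinj : Function.Injective ![a, b, c, d, e] := by
    intro i j hij
    have : ∀ k, (cycleGraph 5).Adj i k ↔ (cycleGraph 5).Adj j k := fun k => by
      rw [← key, ← key, hij]
    have h : ∀ i j : Fin 5, (∀ k, (cycleGraph 5).Adj i k ↔ (cycleGraph 5).Adj j k) → i = j := by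
      decide
    exact h i j this
  have huniv : Set.range ![a, b, c, d, e] = Set.univ := by
    refine hp _ ?_ ⟨_, ⟨0, rfl⟩, _, ⟨1, rfl⟩, ab.ne⟩
    intro v hv
    have hne : ∀ i, v ≠ ![a, b, c, d, e] i := fun i hi => hv ⟨i, hi.symm⟩
    have va : v ≠ a := hne 0
    have vb : v ≠ b := hne 1
    have vc : v ≠ c := hne 2
    have vd : v ≠ d := hne 3
    have ve : v ≠ e := hne 4
    have square : ∀ p q r, p ≠ r → v ≠ q → G.Adj p q → G.Adj q r → ¬ G.Adj p r →
        G.Adj v p → G.Adj v r → G.Adj v q := by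
      intro p q r hpr hvq hpq hqr hn hvp hvr
      by_contra h
      exact h4 v p q r hvq hpr hvp hpq hqr hvr.symm h hn
    have edge : ∀ p q r, G.Adj q r → ¬ G.Adj p q → ¬ G.Adj p r →
        G.Adj v p → G.Adj v q ∨ G.Adj v r := by
      intro p q r hqr hpq hpr hvp
      by_contra! h
      exact h2 q r v p hqr hvp h.1 h.2 hpq hpr
    have ca : ¬ G.Adj c a := fun h => ac h.symm
    have da : ¬ G.Adj d a := fun h => ad h.symm
    have db : ¬ G.Adj d b := fun h => bd h.symm
    have eb : ¬ G.Adj e b := fun h => be h.symm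
    have ec : ¬ G.Adj e c := fun h => ce h.symm
    have e1 := edge a c d cd ac ad
    have e2 := edge b d e de bd be
    have e3 := edge c e a ea ce ca
    have e4 := edge d a b ab da db
    have e5 := edge e b c bc eb ec
    have s1 := square a b c (hinj.ne (by decide : (0 : Fin 5) ≠ 2)) vb ab bc ac
    have s2 := square b c d (hinj.ne (by decide : (1 : Fin 5) ≠ 3)) vc bc cd bd
    have s3 := square c d e (hinj.ne (by decide : (2 : Fin 5) ≠ 4)) vd cd de ce
    have s4 := square d e a (hinj.ne (by decide : (3 : Fin 5) ≠ 0)) ve de ea da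
    have s5 := square e a b (hinj.ne (by decide : (4 : Fin 5) ≠ 1)) va ea ab eb
    simp only [Set.forall_mem_range, Fin.forall_fin_succ, Matrix.cons_val_zero,
      Matrix.cons_val_succ, IsEmpty.forall_iff, and_true]
    clear key hinj hne square edge
    grind
  exact ⟨(⟨Equiv.ofBijective _ ⟨hinj, Set.range_eq_univ.1 huniv⟩, key _ _⟩ :
    cycleGraph 5 ≃g G).symm⟩

theorem IsPrimeGraph.trichotomy [Finite V] (hp : IsPrimeGraph G) (hG : IsP5HouseFree G) :
    IsPentagon G ∨ IsSplitGraph G ∨ (∃ A, IsDivide G A) ∨ ∃ A, IsDivide Gᶜ A := by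
  by_cases h2 : NoTwoEdges G
  · by_cases h4 : NoSquare G
    · by_cases h5 : ∃ a b c d e, IsFiveCycle G a b c d e
      · obtain ⟨a, b, c, d, e, h⟩ := h5
        exact .inl (hp.isPentagon h2 h4 h)
      · exact .inr (.inl (isSplitGraph_of_no_induced h2 h4 (by simpa using h5)))
    · unfold NoSquare at h4
      push Not at h4
      obtain ⟨a, b, c, d, hac, hbd, hab, hbc, hcd, hda, nac, nbd, -⟩ := h4
      -- The diagonals of the square are the two edges of a 2K₂ in the complement.
      have := exists_divide hG.compl hp.compl (a₀ := a) (a₁ := c) (c₀ := b) (c₁ := d) ⟨hac, nac⟩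
        ⟨hbd, nbd⟩ (fun h => h.2 hab.symm) (fun h => h.2 hbc) (fun h => h.2 hda)
        (fun h => h.2 hcd.symm)
      rw [compl_compl] at this
      exact .inr (.inr this.symm)
  · unfold NoTwoEdges at h2
    push Not at h2
    obtain ⟨a, b, c, d, hab, hcd, h1, h2, h3, h4, -⟩ := h2
    exact .inr (.inr (exists_divide hG hp hab hcd h1 h2 h3 h4))

end

/-! ### Decomposing along homogeneous sets and divides -/

theorem card_lt_of_injective_of_notMem_range {α β : Type*} [Finite β] (f : α → β)
    (hf : Function.Injective f) {b : β} (hb : b ∉ Set.range f) : Nat.card α < Nat.card β := by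
  have := Finite.of_injective f hf
  have := Fintype.ofFinite α
  have := Fintype.ofFinite β
  rw [Nat.card_eq_fintype_card, Nat.card_eq_fintype_card]
  exact Fintype.card_lt_of_injective_of_notMem f hf hb

section

variable {V : Type u} {G : SimpleGraph V}

theorem exists_substitution [Finite V] (hG : IsP5HouseFree G) {S : Set V} (hS : IsHomogeneous G S)
    (hnt : S.Nontrivial) (hne : S ≠ Set.univ) :
    ∃ (V₁ V₂ : Type u) (G₁ : SimpleGraph V₁) (G₂ : SimpleGraph V₂) (u : V₂)
      (G' : SimpleGraph (V₁ ⊕ {v : V₂ // v ≠ u})), IsSubstitution G₁ G₂ u G' ∧ Nonempty (G' ≃g G) ∧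
      IsP5HouseFree G₁ ∧ IsP5HouseFree G₂ ∧ Finite V₁ ∧ Finite V₂ ∧
      Nat.card V₁ < Nat.card V ∧ Nat.card V₂ < Nat.card V := by
  classical
  obtain ⟨s, hs, s', hs', hss'⟩ := hnt
  obtain ⟨w, hw⟩ := (Set.ne_univ_iff_exists_notMem S).1 hne
  -- The vertex `s` represents the contracted set `S`.
  let R : Type u := {v : V // v ∉ S ∨ v = s}
  let s₀ : R := ⟨s, .inr rfl⟩
  let θ : S ⊕ {v : R // v ≠ s₀} → V := Sum.elim Subtype.val fun v => v.1.1
  have hR : ∀ v : {v : R // v ≠ s₀}, v.1.1 ∉ S := fun v =>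
    v.1.2.resolve_right fun h => v.2 (Subtype.ext h)
  have hθ : Function.Bijective θ := by
    constructor
    · rintro (x | x) (y | y) h
      · exact congrArg _ (Subtype.ext h)
      · have h' : x.1 = y.1.1 := h
        exact absurd (h' ▸ x.2) (hR y)
      · have h' : x.1.1 = y.1 := h
        exact absurd (h' ▸ y.2) (hR x)
      · exact congrArg _ (Subtype.ext (Subtype.ext h))
    · intro v
      by_cases hv : v ∈ S
      · exact ⟨.inl ⟨v, hv⟩, rfl⟩
      · have hvs : v ≠ s := fun h => hv (h ▸ hs)
        exact ⟨.inr ⟨⟨v, .inl hv⟩, fun h => hvs (congrArg Subtype.val h)⟩, rfl⟩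
  refine ⟨S, R, G.comap Subtype.val, G.comap Subtype.val, s₀, G.comap θ, ⟨?_, ?_, ?_, ?_⟩,
    ⟨Iso.comap (Equiv.ofBijective θ hθ) G⟩,
    hG.of_embedding (Embedding.comap ⟨_, Subtype.val_injective⟩ G),
    hG.of_embedding (Embedding.comap ⟨_, Subtype.val_injective⟩ G), inferInstance, inferInstance,
    card_lt_of_injective_of_notMem_range _ Subtype.val_injective (b := w) (by simpa using hw),
    card_lt_of_injective_of_notMem_range _ Subtype.val_injective (b := s') (by
      rintro ⟨⟨v, hv⟩, rfl⟩
      exact hv.elim (fun h => h hs') fun h => hss' h.symm)⟩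
  · rfl
  · rfl
  · intro v hv x
    rcases hS v.1.1 (hR v) with h | h
    · exact h x x.2
    · exact absurd hv (h s hs)
  · intro v hv x
    rcases hS v.1.1 (hR v) with h | h
    · exact absurd (h s hs) hv
    · exact h x x.2

/-- For use with `i` at the new vertex `a` and `j`, `k` in `L`: the neighbors of `a` lie in `B`,
which is complete to `L`, so no copy contains `a` and two vertices of `L`. -/
theorem IsP5OrHouse.exists_private_neighbor {H : SimpleGraph (Fin 5)} (hH : IsP5OrHouse H)
    {i j k : Fin 5} (hij : ¬ H.Adj i j) (hik : ¬ H.Adj i k) (hjk : H.Adj j k) :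
    ∃ m, H.Adj i m ∧ ¬ (H.Adj m j ∧ H.Adj m k) := by
  revert i j k
  rcases hH with rfl | rfl <;> decide

/-- The second block of a unification, where `ψ` embeds `B ∪ C ∪ L ∪ T` in `G`. -/
def rightBlock {B C L T : Type u} (G : SimpleGraph V) (ψ : VertBCLT B C L T → V) :
    SimpleGraph (Option (VertBCLT B C L T)) where
  Adj
    | some x, some y => G.Adj (ψ x) (ψ y)
    | none, some (.ofB _) => True
    | some (.ofB _), none => True
    | _, _ => False
  symm := ⟨by
    rintro (_ | (x | x | x | x)) (_ | (y | y | y | y)) h <;> first | exact h | exact h.symm⟩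
  loopless := ⟨by rintro (_ | x) h; exacts [h, G.loopless.irrefl _ h]⟩

/-- No single vertex of `A` need be anti-complete to `L`, but each vertex of `L` has a non-neighbor
in `A`. This suffices, because a copy through the new vertex meets `L` at most once, so a suitable
vertex of `A` can replace it. -/
theorem rightBlock_isP5HouseFree {B C L T : Type u} (hG : IsP5HouseFree G)
    {ψ : VertBCLT B C L T → V} (hψ : Function.Injective ψ) {A : Set V} (hne : A.Nonempty)
    (hA : ∀ x, ψ x ∉ A) (hB : ∀ a ∈ A, ∀ x, G.Adj a (ψ (.ofB x)))
    (hC : ∀ a ∈ A, ∀ x, ¬ G.Adj a (ψ (.ofC x))) (hT : ∀ a ∈ A, ∀ x, ¬ G.Adj a (ψ (.ofT x)))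
    (hL : ∀ x, ∃ a ∈ A, ¬ G.Adj a (ψ (.ofL x)))
    (hLL : ∀ x y, x ≠ y → G.Adj (ψ (.ofL x)) (ψ (.ofL y)))
    (hLB : ∀ x y, G.Adj (ψ (.ofL x)) (ψ (.ofB y))) : IsP5HouseFree (rightBlock G ψ) := by
  rw [isP5HouseFree_iff]
  rintro H hH ⟨f⟩
  obtain ⟨a, ha, haL⟩ : ∃ a ∈ A, ∀ i j, f i = none → ∀ x, f j = some (.ofL x) →
      ¬ G.Adj a (ψ (.ofL x)) := by
    by_cases hex : ∃ j x, f j = some (.ofL x)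
    · obtain ⟨j, x, hj⟩ := hex
      obtain ⟨a, ha, hax⟩ := hL x
      refine ⟨a, ha, fun i k hi y hk => ?_⟩
      by_cases hxy : x = y
      · exact hxy ▸ hax
      exfalso
      have h1 : ¬ H.Adj i j := by rw [← f.map_adj_iff, hi, hj]; exact id
      have h2 : ¬ H.Adj i k := by rw [← f.map_adj_iff, hi, hk]; exact id
      have h3 : H.Adj j k := by rw [← f.map_adj_iff, hj, hk]; exact hLL x y hxy
      obtain ⟨m, him, hm⟩ := hH.exists_private_neighbor h1 h2 h3
      rw [← f.map_adj_iff, ← f.map_adj_iff, hj, hk] at hm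
      rw [← f.map_adj_iff, hi] at him
      rcases hfm : f m with _ | (z | z | z | z) <;> rw [hfm] at him hm
      · exact him
      · exact hm ⟨(hLB x z).symm, (hLB y z).symm⟩
      · exact him
      · exact him
      · exact him
    · obtain ⟨a, ha⟩ := hne
      exact ⟨a, ha, fun i j _ x hx => absurd ⟨j, x, hx⟩ hex⟩
  have left : ∀ i j x, f i = none → f j = some x →
      (G.Adj a (ψ x) ↔ (rightBlock G ψ).Adj none (some x)) := by
    rintro i j (x | x | x | x) hi hj
    · exact iff_of_true (hB a ha x) trivial
    · exact iff_of_false (hC a ha x) id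
    · exact iff_of_false (haL i j hi x hj) id
    · exact iff_of_false (hT a ha x) id
  refine isP5HouseFree_iff.1 hG H hH (isIndContained_of_map (fun i => (f i).elim a ψ) ?_ ?_)
  · intro i j hij
    apply f.injective
    rcases hi : f i with _ | x <;> rcases hj : f j with _ | y <;>
      simp only [hi, hj, Option.elim] at hij
    · rfl
    · exact absurd (hij ▸ ha) (hA y)
    · exact absurd (hij ▸ ha) (hA x)
    · rw [hψ hij]
  · intro i j
    rw [← f.map_adj_iff]
    rcases hi : f i with _ | x <;> rcases hj : f j with _ | y <;> simp only [Option.elim]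
    · simp
    · exact left i j y hi hj
    · rw [G.adj_comm, (rightBlock G ψ).adj_comm]
      exact left j i x hj hi
    · rfl

theorem VertALT.elim_incl_injective {A B C L T : Type u} (c : C) : Function.Injective
    fun o : Option (VertALT A L T) => o.elim (VertABCLT.ofC c) (VertALT.incl B C) := by
  rintro (_ | (x | x | x)) (_ | (y | y | y)) h <;> simp_all [VertALT.incl]

theorem VertBCLT.elim_incl_injective {A B C L T : Type u} (a : A) : Function.Injective
    fun o : Option (VertBCLT B C L T) => o.elim (VertABCLT.ofA a) (VertBCLT.incl A) := by
  rintro (_ | (x | x | x | x)) (_ | (y | y | y | y)) h <;> simp_all [VertBCLT.incl]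

theorem IsDivide.exists_unification [Finite V] (hG : IsP5HouseFree G) {A : Set V}
    (hA : IsDivide G A) :
    ∃ (A B C L T : Type u) (G₁ : SimpleGraph (Option (VertALT A L T)))
      (G₂ : SimpleGraph (Option (VertBCLT B C L T))) (G' : SimpleGraph (VertABCLT A B C L T)),
      IsUnification G₁ G₂ G' ∧ Nonempty (G' ≃g G) ∧ IsP5HouseFree G₁ ∧ IsP5HouseFree G₂ ∧
      Finite (Option (VertALT A L T)) ∧ Finite (Option (VertBCLT B C L T)) ∧
      Nat.card (Option (VertALT A L T)) < Nat.card V ∧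
      Nat.card (Option (VertBCLT B C L T)) < Nat.card V := by
  classical
  let B : Set V := {v | ∀ a ∈ A, G.Adj v a}
  let C : Set V := {v | Remote G A v ∧ ∀ x, Mixed G A x → G.Adj v x}
  let L : Set V := {v | Mixed G A v}
  let T : Set V := {v | Remote G A v ∧ ∃ x, Mixed G A x ∧ ¬ G.Adj v x}
  obtain ⟨a, ha, a', ha', haa'⟩ := hA.nontrivial
  obtain ⟨c, d, hcd, hc, hd⟩ := hA.two
  have AB : ∀ v ∈ A, v ∉ B := fun v hv h => (h v hv).ne rfl
  have AC : ∀ v ∈ A, v ∉ C := fun v hv h => h.1.1 hv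
  have AL : ∀ v ∈ A, v ∉ L := fun v hv h => h.1 hv
  have AT : ∀ v ∈ A, v ∉ T := fun v hv h => h.1.1 hv
  have BC : ∀ v ∈ B, v ∉ C := fun v hv h => h.1.2 a ha (hv a ha)
  have BL : ∀ v ∈ B, v ∉ L := fun v hv ⟨_, _, b, hb, hn⟩ => hn (hv b hb)
  have BT : ∀ v ∈ B, v ∉ T := fun v hv h => h.1.2 a ha (hv a ha)
  have CL : ∀ v ∈ C, v ∉ L := fun v hv ⟨_, ⟨b, hb, hn⟩, _⟩ => hv.1.2 b hb hn
  have CT : ∀ v ∈ C, v ∉ T := fun v hv ⟨_, x, hx, hn⟩ => hn (hv.2 x hx)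
  have LT : ∀ v ∈ L, v ∉ T := fun v ⟨_, ⟨b, hb, hn⟩, _⟩ h => h.1.2 b hb hn
  have cover : ∀ v, v ∈ A ∨ v ∈ B ∨ v ∈ C ∨ v ∈ L ∨ v ∈ T := by
    intro v
    by_cases h1 : v ∈ A
    · exact .inl h1
    by_cases h2 : ∃ a ∈ A, G.Adj v a
    · by_cases h3 : v ∈ B
      · exact .inr (.inl h3)
      · refine .inr (.inr (.inr (.inl ⟨h1, h2, ?_⟩)))
        by_contra! h
        exact h3 h
    · push Not at h2
      by_cases h3 : v ∈ C
      · exact .inr (.inr (.inl h3))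
      · refine .inr (.inr (.inr (.inr ⟨⟨h1, h2⟩, ?_⟩)))
        by_contra! h
        exact h3 ⟨⟨h1, h2⟩, h⟩
  let φ : VertABCLT A B C L T → V
    | .ofA x => x
    | .ofB x => x
    | .ofC x => x
    | .ofL x => x
    | .ofT x => x
  have hφ : Function.Bijective φ := by
    constructor
    · rintro (⟨x, hx⟩ | ⟨x, hx⟩ | ⟨x, hx⟩ | ⟨x, hx⟩ | ⟨x, hx⟩)
        (⟨y, hy⟩ | ⟨y, hy⟩ | ⟨y, hy⟩ | ⟨y, hy⟩ | ⟨y, hy⟩) (rfl : x = y) <;> first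
        | rfl
        | exact absurd hy (AB x hx) | exact absurd hx (AB x hy)
        | exact absurd hy (AC x hx) | exact absurd hx (AC x hy)
        | exact absurd hy (AL x hx) | exact absurd hx (AL x hy)
        | exact absurd hy (AT x hx) | exact absurd hx (AT x hy)
        | exact absurd hy (BC x hx) | exact absurd hx (BC x hy)
        | exact absurd hy (BL x hx) | exact absurd hx (BL x hy)
        | exact absurd hy (BT x hx) | exact absurd hx (BT x hy)
        | exact absurd hy (CL x hx) | exact absurd hx (CL x hy)
        | exact absurd hy (CT x hx) | exact absurd hx (CT x hy)
        | exact absurd hy (LT x hx) | exact absurd hx (LT x hy)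
    · intro v
      rcases cover v with h | h | h | h | h
      exacts [⟨.ofA ⟨v, h⟩, rfl⟩, ⟨.ofB ⟨v, h⟩, rfl⟩, ⟨.ofC ⟨v, h⟩, rfl⟩, ⟨.ofL ⟨v, h⟩, rfl⟩,
        ⟨.ofT ⟨v, h⟩, rfl⟩]
  let χ : Option (VertALT A L T) → VertABCLT A B C L T := fun o =>
    o.elim (.ofC ⟨c, hc⟩) (VertALT.incl B C)
  have hχ : Function.Injective χ := by
    exact VertALT.elim_incl_injective _
  have hincl : Function.Injective (VertBCLT.incl A : VertBCLT B C L T → VertABCLT A B C L T) := by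
    exact fun x y h => Option.some_injective _ (VertBCLT.elim_incl_injective ⟨a, ha⟩ h)
  let ψ : VertBCLT B C L T → V := fun x => φ (x.incl A)
  let χ' : Option (VertBCLT B C L T) → VertABCLT A B C L T := fun o =>
    o.elim (.ofA ⟨a, ha⟩) (VertBCLT.incl A)
  have hχ' : Function.Injective χ' := by
    exact VertBCLT.elim_incl_injective _
  have hψ : Function.Injective ψ := hφ.1.comp hincl
  have LL : ∀ x ∈ L, ∀ y ∈ L, x ≠ y → G.Adj x y := fun x hx y hy => hA.clique x y hx hy
  have LB : ∀ x ∈ L, ∀ y ∈ B, G.Adj x y := fun x hx y hy => hA.complete x y hx hy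
  have iso : ∀ t ∈ T, ∀ w, Remote G A w → ¬ G.Adj t w := fun t ⟨ht, x, hx, hn⟩ w hw =>
    hA.isolated t x ht hx hn w hw
  have remoteA : ∀ v, Remote G A v → ∀ a ∈ A, ¬ G.Adj a v := fun v hv a ha h => hv.2 a ha h.symm
  -- The vertex `c` of the first block is an actual vertex of `C`. That block omits `d` and the
  -- second one is no larger than a vertex set omitting `a'`, so both are smaller than `G`.
  refine ⟨A, B, C, L, T, G.comap (φ ∘ χ), rightBlock G ψ, G.comap φ, ⟨?_, rfl, rfl, ?_, ?_⟩,
    ⟨Iso.comap (Equiv.ofBijective φ hφ) G⟩,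
    hG.of_embedding (Embedding.comap ⟨_, hφ.1.comp hχ⟩ G),
    rightBlock_isP5HouseFree hG hψ ⟨a, ha⟩ ?_ (fun a ha x => (x.2 a ha).symm)
      (fun a ha x => remoteA _ x.2.1 a ha) (fun a ha x => remoteA _ x.2.1 a ha) ?_
      (fun x y hxy => LL _ x.2 _ y.2 fun h => hxy (Subtype.ext h)) (fun x y => LB _ x.2 _ y.2),
    Finite.of_injective _ (hφ.1.comp hχ), Finite.of_injective _ (hφ.1.comp hχ'),
    card_lt_of_injective_of_notMem_range _ (hφ.1.comp hχ) (b := d) ?_,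
    card_lt_of_injective_of_notMem_range _ (hφ.1.comp hχ') (b := a') ?_⟩
  · exact {
      nonempty_A := ⟨a, ha⟩
      nonempty_C := ⟨c, hc⟩
      clique_L := fun x y hxy => LL _ x.2 _ y.2 fun h => hxy (Subtype.ext h)
      stable_T := fun x y => iso _ x.2 _ y.2.1
      A_anticomplete_T := fun x y => remoteA _ y.2.1 _ x.2
      c_complete_L := fun x => hc.2 x x.2
      c_anticomplete_A := fun x => hc.1.2 x x.2
      c_anticomplete_T := fun x h => iso _ x.2 _ hc.1 h.symm
      core_eq := by
        ext (x | x) (y | y) <;> rfl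
      T_anticomplete_C := fun x y => iso _ x.2 _ y.2.1
      L_complete_B := fun x y => LB _ x.2 _ y.2
      L_complete_C := fun x y => (y.2.2 x x.2).symm
      a_complete_B := fun x => trivial
      a_anticomplete_C := fun x => id
      a_anticomplete_L := fun x => id
      a_anticomplete_T := fun x => id }
  · exact fun x y => (y.2 x x.2).symm
  · exact fun x y => remoteA _ y.2.1 _ x.2
  · rintro (x | x | x | x) h
    exacts [AB _ h x.2, AC _ h x.2, AL _ h x.2, AT _ h x.2]
  · rintro ⟨x, hx⟩
    obtain ⟨b, hb, hn⟩ := hx.2.2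
    exact ⟨b, hb, fun h => hn h.symm⟩
  · rintro ⟨_ | (x | x | x), h⟩
    · exact hcd h
    · exact AC _ ((h : x.1 = d) ▸ x.2) hd
    · exact CL _ hd ((h : x.1 = d) ▸ x.2)
    · exact CT _ hd ((h : x.1 = d) ▸ x.2)
  · rintro ⟨_ | (x | x | x | x), h⟩
    · exact haa' h
    · exact AB _ ha' ((h : x.1 = a') ▸ x.2)
    · exact AC _ ha' ((h : x.1 = a') ▸ x.2)
    · exact AL _ ha' ((h : x.1 = a') ▸ x.2)
    · exact AT _ ha' ((h : x.1 = a') ▸ x.2)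

/-- The complements of isomorphic graphs are isomorphic. -/
def complIso {V W : Type*} {G : SimpleGraph V} {H : SimpleGraph W} (e : G ≃g H) : Gᶜ ≃g Hᶜ :=
  ⟨e.toEquiv, by intro a b; simp [compl_adj, e.map_adj_iff]⟩

theorem IsP5HouseFree.obtained [Finite V] (hG : IsP5HouseFree G) : Obtained G := by
  induction hn : Nat.card V using Nat.strong_induction_on generalizing V with
  | h n ih =>
  subst hn
  by_cases hp : IsPrimeGraph G
  · rcases hp.trichotomy hG with h | h | ⟨A, hA⟩ | ⟨A, hA⟩
    · exact .pentagon h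
    · exact .split h
    · obtain ⟨_, _, _, _, _, G₁, G₂, G', hU, ⟨e⟩, h₁, h₂, _, _, l₁, l₂⟩ :=
        hA.exists_unification hG
      exact .iso e (.unification hU (ih _ l₁ h₁ rfl) (ih _ l₂ h₂ rfl))
    · obtain ⟨_, _, _, _, _, G₁, G₂, G', hU, ⟨e⟩, h₁, h₂, _, _, l₁, l₂⟩ :=
        hA.exists_unification hG.compl
      have e' := complIso e
      rw [compl_compl] at e'
      exact .iso e' (.unificationCompl (by rwa [compl_compl]) (ih _ l₁ h₁ rfl) (ih _ l₂ h₂ rfl))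
  · unfold IsPrimeGraph at hp
    push Not at hp
    obtain ⟨S, hS, hnt, hne⟩ := hp
    obtain ⟨_, _, G₁, G₂, u, G', hU, ⟨e⟩, h₁, h₂, _, _, l₁, l₂⟩ :=
      exists_substitution hG hS hnt hne
    exact .iso e (.substitution hU (ih _ l₁ h₁ rfl) (ih _ l₂ h₂ rfl))

end

end SplitUnif

theorem theorem5p2 {V : Type u} [Finite V] (G : SimpleGraph V) :
    SplitUnif.IsP5HouseFree G ↔ SplitUnif.Obtained G :=
  ⟨fun h => h.obtained, fun h => h.isP5HouseFree⟩
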